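/- Let $n\ge 1$, let $d\gamma(x)=\pi^{-n/2}e^{-|x|^2}\,dx$ be the Gauss measure on $\mathbb{R}^n$, and let $m(x)=\min\{1,1/|x|\}$ (with $m(0)=1$). For $a>0$ let $\mathcal{B}_a$ be the set of open balls $B\subset\mathbb{R}^n$ whose centre $c_B$ and radius $r_B>0$ satisfy $r_B\le a\,m(c_B)$, and let $\mathcal{B}_a(x)$ be the set of $B\in\mathcal{B}_a$ with $x\in B$. All functions are real-valued. For $f\in L^1(\gamma)$ put $$\|f\|_*=\sup_{B\in\mathcal{B}_1}\frac1{\gamma(B)}\int_B|f-f_B|\,d\gamma,\qquad f_B=\frac1{\gamma(B)}\int_B f\,d\gamma;$$ $f$ belongs to $\mathrm{BMO}(\gamma)$ if $\|f\|_*<\infty$, and then $\|f\|_{\mathrm{BMO}(\gamma)}=\|f\|_*+\|f\|_{L^1(\gamma)}$. Let $L^\infty_c(\gamma)$ be the set of compactly supported functions in $L^\infty(\gamma)$, and let $b^-=-\min\{0,b\}$. For $\beta\in(0,1)$ and $f$ locally integrable let $$\mathcal{M}_a^\beta(f)(x)=\sup_{B\in\mathcal{B}_a(x)}\frac1{\gamma(B)^{1-\beta}}\int_B|f|\,d\gamma,$$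 and for $b\in L^1(\gamma)$ and $f\in L^\infty_c(\gamma)$ let $[b,\mathcal{M}_a^\beta](f)=b\,\mathcal{M}_a^\beta(f)-\mathcal{M}_a^\beta(bf)$ (with values in $[-\infty,\infty]$). **Theorem 1.3.** Let $a\in(0,\infty)$, $\beta\in(0,1)$, $1<p<q<\infty$ and $1/q=1/p-\beta$. Then there exists a positive constant $C$, depending only on $n$, $a$, $p$ and $q$, such that the following hold. (i) If $b\in\mathrm{BMO}(\gamma)$ and $b^-\in L^\infty(\gamma)$, then for all $f\in L^\infty_c(\gamma)$ the function $[b,\mathcal{M}_a^\beta](f)$ is $\gamma$-measurable and $$\|[b,\mathcal{M}_a^\beta](f)\|_{L^q(\gamma)}\le C\left(\|b\|_*+\|b^-\|_{L^\infty(\gamma)}\right)\|f\|_{L^p(\gamma)}.$$ (ii) If $b\in L^1(\gamma)$ and $[b,\mathcal{M}_a^\beta]$ is bounded from $L^p(\gamma)\cap L^\infty_c(\gamma)$ to $L^q(\gamma)$ (that is, for some $K<\infty$, $\|[b,\mathcal{M}_a^\beta](f)\|_{L^q(\gamma)}\le K\|f\|_{L^p(\gamma)}$ for all $f\in L^p(\gamma)\cap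 L^\infty_c(\gamma)$), then $b\in\mathrm{BMO}(\gamma)$, $b^-\in L^\infty(\gamma)$ and $$\|b\|_{\mathrm{BMO}(\gamma)}+\|b^-\|_{L^\infty(\gamma)}\le\|b\|_{L^1(\gamma)}+C\,\|[b,\mathcal{M}_a^\beta]\|_{L^p(\gamma)\to L^q(\gamma)},$$ where $$\|[b,\mathcal{M}_a^\beta]\|_{L^p(\gamma)\to L^q(\gamma)}=\sup\left\{\|[b,\mathcal{M}_a^\beta](f)\|_{L^q(\gamma)}:\ f\in L^\infty_c(\gamma),\ \|f\|_{L^p(\gamma)}=1\right\}.$$ -/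

import Mathlib

open MeasureTheory
open scoped ENNReal NNReal

noncomputable section

namespace GaussBMO

/-- Euclidean space of dimension `n`, with the Euclidean norm. -/
abbrev E (n : ℕ) : Type := EuclideanSpace ℝ (Fin n)

/-- The Gauss measure `dγ(x) = π^(-n/2) exp(-|x|²) dx`. -/
def gauss (n : ℕ) : Measure (E n) :=
  (volume : Measure (E n)).withDensity
    (fun x => ENNReal.ofReal (Real.pi ^ (-(n : ℝ) / 2) * Real.exp (-‖x‖ ^ 2)))

/-- The function `m(x) = min {1, 1/|x|}`, with the usual convention `1/0 = ∞`, so that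
`m(0) = 1`; see `m_zero` and `m_eq_min`. -/
def m {n : ℕ} (x : E n) : ℝ := (max 1 ‖x‖)⁻¹

theorem m_zero (n : ℕ) : m (0 : E n) = 1 := by simp [m]

theorem m_eq_min {n : ℕ} {x : E n} (hx : x ≠ 0) : m x = min 1 (1 / ‖x‖) := by
  have h : 0 < ‖x‖ := norm_pos_iff.mpr hx
  unfold m
  rcases le_total 1 ‖x‖ with h1 | h1
  · rw [max_eq_right h1, min_eq_right ((div_le_one h).mpr h1), one_div]
  · rw [max_eq_left h1, min_eq_left ((one_le_div h).mpr h1), inv_one]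

/-- The (open) ball with centre `c` and radius `r` belongs to the admissible class `𝓑_a`. -/
def Admissible {n : ℕ} (a : ℝ) (c : E n) (r : ℝ) : Prop := 0 < r ∧ r ≤ a * m c

/-- The seminorm `‖f‖_*`: the supremum over the balls of `𝓑_1` of the mean oscillation of `f`
with respect to the Gauss measure, as an extended nonnegative number. -/
def bmoSeminorm {n : ℕ} (f : E n → ℝ) : ℝ≥0∞ :=
  ⨆ (c : E n) (r : ℝ) (_ : Admissible 1 c r),
    (∫⁻ x in Metric.ball c r, ‖f x - ⨍ y in Metric.ball c r, f y ∂(gauss n)‖ₑ ∂(gauss n))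
      / gauss n (Metric.ball c r)

/-- Membership in `BMO(γ)`. -/
def MemBMO {n : ℕ} (f : E n → ℝ) : Prop :=
  MemLp f 1 (gauss n) ∧ bmoSeminorm f < ∞

/-- The norm `‖f‖_{BMO(γ)} = ‖f‖_* + ‖f‖_{L¹(γ)}`. -/
def bmoNorm {n : ℕ} (f : E n → ℝ) : ℝ≥0∞ :=
  bmoSeminorm f + eLpNorm f 1 (gauss n)

/-- The local fractional maximal function `𝓜_a^β f`, with values in `[0, ∞]`. -/
def fracMaximal {n : ℕ} (a β : ℝ) (f : E n → ℝ) (x : E n) : ℝ≥0∞ :=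
  ⨆ (c : E n) (r : ℝ) (_ : Admissible a c r) (_ : x ∈ Metric.ball c r),
    (∫⁻ y in Metric.ball c r, ‖f y‖ₑ ∂(gauss n)) / (gauss n (Metric.ball c r)) ^ (1 - β)

/-- The commutator `[b, 𝓜_a^β](f) = b 𝓜_a^β(f) - 𝓜_a^β(b f)`. For bounded `f` the first term is
a real number at every point, while `𝓜_a^β(b f)` may be infinite at some points; the difference is
therefore taken in the extended reals. -/
def commutator {n : ℕ} (a β : ℝ) (b f : E n → ℝ) (x : E n) : EReal :=
  (b x : EReal) * (fracMaximal a β f x : EReal)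
    - (fracMaximal a β (fun y => b y * f y) x : EReal)

/-- The `L^q(γ)` norm, in `[0, ∞]`, of an extended real valued function. -/
def eLqNorm {n : ℕ} (q : ℝ) (g : E n → EReal) : ℝ≥0∞ :=
  (∫⁻ x, (g x).abs ^ q ∂(gauss n)) ^ (1 / q)

/-- `L_c^∞(γ)`: the functions of `L^∞(γ)` with compact support. -/
def MemLcInfty {n : ℕ} (f : E n → ℝ) : Prop :=
  MemLp f ∞ (gauss n) ∧ HasCompactSupport f

/-- The negative part `f⁻ = -min {0, f}`. -/
def negPartFun {n : ℕ} (f : E n → ℝ) (x : E n) : ℝ := -min 0 (f x)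

/-- `[b, 𝓜_a^β]` is bounded from `L^p(γ) ∩ L_c^∞(γ)` to `L^q(γ)`. -/
def CommutatorBounded {n : ℕ} (a β p q : ℝ) (b : E n → ℝ) : Prop :=
  ∃ K : ℝ≥0, ∀ f : E n → ℝ, MemLp f (ENNReal.ofReal p) (gauss n) → MemLcInfty f →
    eLqNorm q (commutator a β b f) ≤ K * eLpNorm f (ENNReal.ofReal p) (gauss n)

/-- The norm `sup {‖[b, 𝓜_a^β](f)‖_{L^q(γ)} : f ∈ L_c^∞(γ), ‖f‖_{L^p(γ)} = 1}`. -/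
def commutatorNorm {n : ℕ} (a β p q : ℝ) (b : E n → ℝ) : ℝ≥0∞ :=
  ⨆ (f : E n → ℝ) (_ : MemLcInfty f) (_ : eLpNorm f (ENNReal.ofReal p) (gauss n) = 1),
    eLqNorm q (commutator a β b f)

end GaussBMO

end

/-! On a ball of radius at most `a * m c` the quantity `‖x‖ ^ 2` varies by a bounded amount, so the
Gauss density is nearly constant there and `gauss n` is doubling on admissible balls
(`exists_gauss_ball_le`). Vitali coverings, maximal theorems and the John–Nirenberg argument
therefore survive, provided that every ball used stays in some class `𝓑_A`.

Sufficiency. Since `||b x| - |b y|| ≤ |b x - b y|`, the commutator is at most a maximal commutator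
plus `2 b⁻ 𝓜 f`, the last term correcting the sign where `b x < 0` (`abs_commutator_le`). The
correction is handled by the boundedness of `b⁻` and the `L^p → L^q` bound for `𝓜`, which follows
from Hedberg's inequality and the local maximal theorem. In the maximal commutator, `b x - b y` is
split at the mean `b_B`. Hölder's inequality treats `b_B - b y`; a Vitali selection at each dyadic
level of `𝓜 g` treats `b x - b_B` (`exists_lintegral_oscMax_rpow_le`). Both need power oscillations
over balls larger than those of `𝓑_1`: John–Nirenberg supplies the powers (`exists_oscBound_rpow`)
and a chaining argument the larger balls (`exists_oscBound_enlarge`).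

Necessity. Testing on a normalised indicator of a ball `B`, whose maximal function is known exactly
on `B`, bounds the mean over `B` of `(|b|_B - b)⁺` by the commutator norm
(`lintegral_ofReal_average_abs_sub_le`). This is read twice: `|b|_B ≥ b_B` gives half of the mean
oscillation, and the mean of `|b|_B - b` equals that of `|b| - b = 2 b⁻`, which gives the bound on
`b⁻` by differentiation. -/

namespace GaussBMO

open Metric Set Filter
open scoped Topology

variable {n : ℕ}

/-! ### The Gauss measure and admissible balls -/

/-- The density of the Gauss measure. -/
noncomputable def gaussDensity (n : ℕ) (x : E n) : ℝ≥0∞ :=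
  ENNReal.ofReal (Real.pi ^ (-(n : ℝ) / 2) * Real.exp (-‖x‖ ^ 2))

lemma measurable_gaussDensity : Measurable (gaussDensity n) := by
  unfold gaussDensity
  fun_prop

lemma gaussDensity_ne_zero (x : E n) : gaussDensity n x ≠ 0 := by
  unfold gaussDensity
  have : 0 < Real.pi ^ (-(n : ℝ) / 2) * Real.exp (-‖x‖ ^ 2) := by positivity
  simpa using this

lemma gauss_eq : gauss n = (volume : Measure (E n)).withDensity (gaussDensity n) := rfl

instance isFiniteMeasure_gauss : IsFiniteMeasure (gauss n) := by
  have h : Integrable (fun x : E n => Real.pi ^ (-(n : ℝ) / 2) * Real.exp (-‖x‖ ^ 2)) := by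
    refine Integrable.const_mul ?_ _
    have h1 : (∫ x : E n, Real.exp (-1 * ‖x‖ ^ 2)) ≠ 0 := by
      rw [GaussianFourier.integral_rexp_neg_mul_sq_norm one_pos]
      positivity
    simpa using Integrable.of_integral_ne_zero h1
  rw [gauss_eq]
  exact isFiniteMeasure_withDensity_ofReal h.2

lemma gauss_absolutelyContinuous : gauss n ≪ volume := withDensity_absolutelyContinuous _ _

lemma gauss_ball_ne_zero (c : E n) {r : ℝ} (hr : 0 < r) : gauss n (ball c r) ≠ 0 := by
  intro h
  have h' : (volume : Measure (E n)) ≪ gauss n :=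
    withDensity_absolutelyContinuous' measurable_gaussDensity.aemeasurable
      (ae_of_all _ gaussDensity_ne_zero)
  exact (measure_ball_pos volume c hr).ne' (h' h)

lemma ball_ae_eq_closedBall (c : E n) {r : ℝ} (hr : 0 < r) :
    ball c r =ᵐ[gauss n] closedBall c r := by
  have h : (ball c r : Set (E n)) =ᵐ[volume] closedBall c r := by
    refine (ae_eq_of_subset_of_measure_ge ball_subset_closedBall ?_
      measurableSet_ball.nullMeasurableSet measure_closedBall_lt_top.ne)
    rw [Measure.addHaar_closedBall _ _ hr.le, Measure.addHaar_ball_of_pos _ _ hr]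
  exact gauss_absolutelyContinuous.ae_eq h

lemma m_pos (x : E n) : 0 < m x := by unfold m; positivity

lemma m_le_one (x : E n) : m x ≤ 1 := by
  unfold m
  exact inv_le_one_of_one_le₀ (le_max_left _ _)

lemma norm_mul_m_le (x : E n) : ‖x‖ * m x ≤ 1 := by
  unfold m
  rw [← div_eq_mul_inv]
  exact div_le_one_of_le₀ (le_max_right _ _) (by positivity)

/-- Since `m ≤ 1`, the hypothesis gives `‖x‖ ≤ ‖c‖ + A`. Recentring a ball at a nearby point thus
keeps it admissible after a change of parameter. -/
lemma m_le_mul_m {A : ℝ} (hA : 0 ≤ A) {c x : E n} (h : dist x c ≤ A * m c) :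
    m c ≤ (1 + A) * m x := by
  have h1 : ‖x‖ ≤ ‖c‖ + A := by
    have := norm_le_norm_add_norm_sub' x c
    rw [← dist_eq_norm] at this
    nlinarith [m_le_one c]
  have h2 : max 1 ‖x‖ ≤ (1 + A) * max 1 ‖c‖ := by
    have h3 := le_max_left 1 ‖c‖
    have h4 := le_max_right 1 ‖c‖
    apply max_le <;> nlinarith
  unfold m
  have h5 : 0 < max 1 ‖x‖ := by positivity
  have h6 : 0 < max 1 ‖c‖ := by positivity
  rw [← div_eq_mul_inv, le_div_iff₀ h5, inv_mul_le_iff₀ h6]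
  linarith

lemma Admissible.mono {a A : ℝ} (h : a ≤ A) {c : E n} {r : ℝ} (hr : Admissible a c r) :
    Admissible A c r :=
  ⟨hr.1, hr.2.trans (mul_le_mul_of_nonneg_right h (m_pos c).le)⟩

lemma Admissible.le {a : ℝ} (ha : 0 ≤ a) {c : E n} {r : ℝ} (hr : Admissible a c r) : r ≤ a :=
  hr.2.trans (mul_le_of_le_one_right ha (m_le_one c))

lemma Admissible.mul {a l : ℝ} (hl : 0 < l) {c : E n} {r : ℝ} (hr : Admissible a c r) :
    Admissible (l * a) c (l * r) :=
  ⟨mul_pos hl hr.1, by rw [mul_assoc]; exact mul_le_mul_of_nonneg_left hr.2 hl.le⟩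

/-- The difference of squares is at most `r (2‖c‖ + r)`, and `r ‖c‖ ≤ A` because `‖c‖ m(c) ≤ 1`.
This is where the scale `m` matters. -/
lemma abs_norm_sq_sub_le {A : ℝ} (hA : 0 ≤ A) {c : E n} {r : ℝ} (hr : Admissible A c r) {y : E n}
    (hy : y ∈ ball c r) : |‖y‖ ^ 2 - ‖c‖ ^ 2| ≤ 2 * A + A ^ 2 := by
  have h1 : |‖y‖ - ‖c‖| ≤ r := (abs_norm_sub_norm_le y c).trans (by
    rw [← dist_eq_norm]; exact (mem_ball.1 hy).le)
  have h2 : |‖y‖ + ‖c‖| ≤ 2 * ‖c‖ + r := by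
    rw [abs_of_nonneg (by positivity)]
    linarith [(abs_le.1 h1).2]
  have h3 : ‖y‖ ^ 2 - ‖c‖ ^ 2 = (‖y‖ - ‖c‖) * (‖y‖ + ‖c‖) := by ring
  rw [h3, abs_mul]
  have h4 := hr.le hA
  have h5 : r * ‖c‖ ≤ A := by
    nlinarith [hr.2, norm_mul_m_le c, norm_nonneg c]
  have h6 : 0 < r := hr.1
  calc |‖y‖ - ‖c‖| * |‖y‖ + ‖c‖| ≤ r * (2 * ‖c‖ + r) :=
        mul_le_mul h1 h2 (abs_nonneg _) hr.1.le
    _ ≤ 2 * A + A ^ 2 := by nlinarith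

/-- Gauss measures of admissible balls are comparable with those of subballs of comparable
radius. -/
lemma exists_gauss_ball_le (n : ℕ) {A L : ℝ} (hA : 0 < A) (hL : 0 < L) :
    ∃ D : ℝ≥0, 1 ≤ D ∧ ∀ (c x : E n) (r ρ : ℝ), Admissible A c r → r ≤ L * ρ →
      ball x ρ ⊆ ball c r → gauss n (ball c r) ≤ D * gauss n (ball x ρ) := by
  set κ := 2 * A + A ^ 2 with hκ
  -- One factor `exp κ` bounds the density above on the large ball, the other bounds it below on the
  -- small one, and `L ^ n` compares the volumes.
  set D₀ : ℝ := Real.exp κ * Real.exp κ * L ^ n with hD₀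
  have hD₀pos : 0 < D₀ := by positivity
  refine ⟨max 1 (Real.toNNReal D₀), le_max_left _ _, fun c x r ρ hr hrρ hsub => ?_⟩
  have hρ : 0 < ρ := by
    have := hr.1
    by_contra h
    nlinarith
  set w : ℝ := Real.pi ^ (-(n : ℝ) / 2) * Real.exp (-‖c‖ ^ 2) with hw
  have hwpos : 0 < w := by positivity
  have hup : ∀ y ∈ ball c r, gaussDensity n y ≤ ENNReal.ofReal (w * Real.exp κ) := by
    intro y hy
    apply ENNReal.ofReal_le_ofReal
    rw [hw, mul_assoc, ← Real.exp_add]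
    have := (abs_le.1 (abs_norm_sq_sub_le hA.le hr hy)).1
    gcongr
    linarith
  have hlow : ∀ y ∈ ball x ρ, ENNReal.ofReal (w * (Real.exp κ)⁻¹) ≤ gaussDensity n y := by
    intro y hy
    apply ENNReal.ofReal_le_ofReal
    rw [hw, mul_assoc, ← Real.exp_neg, ← Real.exp_add]
    have := (abs_le.1 (abs_norm_sq_sub_le hA.le hr (hsub hy))).2
    gcongr
    linarith
  have h1 : gauss n (ball c r) ≤ ENNReal.ofReal (w * Real.exp κ) * volume (ball c r) := by
    rw [gauss_eq, withDensity_apply _ measurableSet_ball, ← setLIntegral_const]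
    exact setLIntegral_mono measurable_const hup
  have h2 : ENNReal.ofReal (w * (Real.exp κ)⁻¹) * volume (ball x ρ) ≤ gauss n (ball x ρ) := by
    rw [gauss_eq, withDensity_apply _ measurableSet_ball, ← setLIntegral_const]
    exact setLIntegral_mono measurable_gaussDensity hlow
  have h3 : volume (ball c r) ≤ ENNReal.ofReal (L ^ n) * volume (ball x ρ) := by
    rw [Measure.addHaar_ball_of_pos _ c hr.1, Measure.addHaar_ball_of_pos _ x hρ, ← mul_assoc,
      ← ENNReal.ofReal_mul (by positivity), finrank_euclideanSpace_fin, ← mul_pow]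
    have := hr.1
    gcongr
  calc gauss n (ball c r)
      ≤ ENNReal.ofReal (w * Real.exp κ) * (ENNReal.ofReal (L ^ n) * volume (ball x ρ)) := by
        exact h1.trans (by gcongr)
    _ = ENNReal.ofReal D₀ * (ENNReal.ofReal (w * (Real.exp κ)⁻¹) * volume (ball x ρ)) := by
        rw [← mul_assoc, ← mul_assoc, ← ENNReal.ofReal_mul (by positivity),
          ← ENNReal.ofReal_mul (by positivity)]
        congr 2
        rw [hD₀]
        field_simp
    _ ≤ (max 1 (Real.toNNReal D₀) : ℝ≥0) * gauss n (ball x ρ) := by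
        gcongr
        rw [ENNReal.ofReal]
        exact_mod_cast le_max_right _ _

/-! ### Covering and differentiation -/

/-- Vitali covering lemma for balls of bounded radius, with a countable index set. -/
lemma exists_vitali_subfamily {F : Set (E n × ℝ)} {R : ℝ} (hF : ∀ p ∈ F, 0 < p.2 ∧ p.2 ≤ R) :
    ∃ u ⊆ F, u.Countable ∧ (u.PairwiseDisjoint fun p => ball p.1 p.2) ∧
      ∀ p ∈ F, ∃ q ∈ u, ball p.1 p.2 ⊆ ball q.1 (5 * q.2) := by
  obtain ⟨u, hu, hd, hc⟩ := Vitali.exists_disjoint_subfamily_covering_enlargement_ball F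
    (fun p => p.1) (fun p => p.2) R (fun p hp => (hF p hp).2) 5 (by norm_num)
  exact ⟨u, hu, hd.countable_of_isOpen (fun _ _ => isOpen_ball)
    (fun p hp => ⟨p.1, mem_ball_self (hF p (hu hp)).1⟩), hd, hc⟩

lemma tsum_setLIntegral_le {u : Set (E n × ℝ)} (hu : u.Countable)
    (hd : u.PairwiseDisjoint fun p => ball p.1 p.2) {s : Set (E n)}
    (hs : ∀ p ∈ u, ball p.1 p.2 ⊆ s) (g : E n → ℝ≥0∞) :
    ∑' p : u, ∫⁻ y in ball p.1.1 p.1.2, g y ∂(gauss n) ≤ ∫⁻ y in s, g y ∂(gauss n) := by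
  rw [← lintegral_biUnion hu (fun _ _ => measurableSet_ball) hd]
  exact lintegral_mono_set (iUnion₂_subset hs)

/-- The Besicovitch differentiation theorem concerns closed balls; spheres are null, so open balls
may replace them. -/
lemma ae_tendsto_lintegral_ball_div {g : E n → ℝ≥0∞} (hg : AEMeasurable g (gauss n))
    (hg' : ∫⁻ y, g y ∂(gauss n) ≠ ∞) :
    ∀ᵐ x ∂(gauss n), Tendsto
      (fun r => (∫⁻ y in ball x r, g y ∂(gauss n)) / gauss n (ball x r)) (𝓝[>] 0) (𝓝 (g x)) := by
  filter_upwards [VitaliFamily.ae_tendsto_lintegral_div (Besicovitch.vitaliFamily (gauss n)) hg hg']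
    with x hx
  refine (hx.comp (Besicovitch.tendsto_filterAt (gauss n) x)).congr' ?_
  filter_upwards [self_mem_nhdsWithin] with r hr
  have h := ball_ae_eq_closedBall x hr
  simp only [Function.comp, setLIntegral_congr h, measure_congr h]

/-! ### Averages -/

/-- The mean value of `b` over the ball with centre `c` and radius `r`. -/
noncomputable def ballAvg (b : E n → ℝ) (c : E n) (r : ℝ) : ℝ :=
  ⨍ y in ball c r, b y ∂(gauss n)

lemma enorm_ballAvg_sub_mul_le {b : E n → ℝ} (hb : Integrable b (gauss n)) (κ : ℝ) (c : E n) (r : ℝ) :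
    ‖ballAvg b c r - κ‖ₑ * gauss n (ball c r) ≤ ∫⁻ y in ball c r, ‖b y - κ‖ₑ ∂(gauss n) := by
  by_cases h0 : gauss n (ball c r) = 0
  · simp [h0]
  have hfin : gauss n (ball c r) ≠ ∞ := measure_ne_top _ _
  have hR : (gauss n).real (ball c r) ≠ 0 := by
    rw [Measure.real]; exact (ENNReal.toReal_pos h0 hfin).ne'
  have h1 : ∫ y in ball c r, (b y - κ) ∂(gauss n)
      = (gauss n).real (ball c r) * (ballAvg b c r - κ) := by
    rw [integral_sub hb.integrableOn (integrable_const _), ballAvg, setAverage_eq, setIntegral_const]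
    simp only [smul_eq_mul]
    field_simp
  have h2 := enorm_integral_le_lintegral_enorm (μ := (gauss n).restrict (ball c r))
    (fun y => b y - κ)
  rw [h1, enorm_mul, mul_comm] at h2
  convert h2 using 2
  rw [Real.enorm_eq_ofReal measureReal_nonneg, Measure.real, ENNReal.ofReal_toReal hfin]

lemma enorm_sub_le_add (x y z : ℝ) : ‖x - z‖ₑ ≤ ‖x - y‖ₑ + ‖y - z‖ₑ := by
  have := enorm_add_le (x - y) (y - z)
  simpa using this

lemma aemeasurable_enorm_sub {b : E n → ℝ} (hb : Integrable b (gauss n)) (κ : ℝ) :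
    AEMeasurable (fun y => ‖b y - κ‖ₑ) (gauss n) :=
  (hb.aemeasurable.sub_const κ).enorm

lemma lintegral_enorm_sub_ne_top {b : E n → ℝ} (hb : Integrable b (gauss n)) (κ : ℝ) :
    ∫⁻ y, ‖b y - κ‖ₑ ∂(gauss n) ≠ ∞ :=
  (hb.sub (integrable_const κ)).2.ne

/-! ### Dyadic sums -/

/-- A geometric series dominated by its largest term. With the converse `rpow_le_tsum_zpow_rpow`, it
serves as a discrete layer-cake formula. -/
lemma exists_tsum_zpow_rpow_le {θ : ℝ} (hθ : 0 < θ) :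
    ∃ C : ℝ≥0, 0 < C ∧ ∀ y : ℝ≥0∞,
      ∑' k : ℤ, (if (2 : ℝ≥0∞) ^ k < y then ((2 : ℝ≥0∞) ^ k) ^ θ else 0) ≤ C * y ^ θ := by
  set ρ : ℝ≥0∞ := ((2 : ℝ≥0∞) ^ θ)⁻¹ with hρ
  have hρ1 : ρ < 1 := by
    rw [hρ, ENNReal.inv_lt_one]
    exact ENNReal.one_lt_rpow (by norm_num) hθ
  have hfin : (1 - ρ)⁻¹ ≠ ∞ := by
    rw [ne_eq, ENNReal.inv_eq_top, tsub_eq_zero_iff_le, not_le]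
    exact hρ1
  -- The `+ 1` makes positivity immediate; it is needed when `y = ∞`, so that the right-hand side is
  -- infinite.
  refine ⟨(1 - ρ)⁻¹.toNNReal + 1, by positivity, fun y => ?_⟩
  have hC : (1 - ρ)⁻¹ ≤ (((1 - ρ)⁻¹.toNNReal + 1 : ℝ≥0) : ℝ≥0∞) := by
    rw [ENNReal.coe_add, ENNReal.coe_toNNReal hfin]
    exact le_self_add
  rcases eq_or_ne y 0 with rfl | h0
  · simp
  rcases eq_or_ne y ∞ with rfl | htop
  · rw [ENNReal.top_rpow_of_pos hθ, ENNReal.mul_top (by positivity)]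
    exact le_top
  obtain ⟨j, hj1, hj2⟩ := ENNReal.exists_mem_Ioc_zpow h0 htop (y := 2) (by norm_num) (by norm_num)
  have hle : ∀ k : ℤ, (2 : ℝ≥0∞) ^ k < y → k ≤ j := by
    intro k hk
    by_contra h
    have : (2 : ℝ≥0∞) ^ (j + 1) ≤ 2 ^ k := ENNReal.zpow_le_of_le (by norm_num) (by omega)
    exact absurd (hk.trans_le (hj2.trans this)) (lt_irrefl _)
  have hinj : Function.Injective (fun i : ℕ => j - (i : ℤ)) := by
    intro i i' h
    simpa using h
  rw [← hinj.tsum_eq]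
  · have hterm : ∀ i : ℕ, (if (2 : ℝ≥0∞) ^ (j - (i : ℤ)) < y then
        ((2 : ℝ≥0∞) ^ (j - (i : ℤ))) ^ θ else 0) ≤ y ^ θ * ρ ^ i := by
      intro i
      have h2 : ((2 : ℝ≥0∞) ^ (j - (i : ℤ))) ^ θ = ((2 : ℝ≥0∞) ^ j) ^ θ * ρ ^ i := by
        rw [sub_eq_add_neg, ENNReal.zpow_add (by norm_num) (by norm_num),
          ENNReal.mul_rpow_of_nonneg _ _ hθ.le, ENNReal.zpow_neg, zpow_natCast,
          ENNReal.inv_rpow, ← ENNReal.rpow_natCast, ← ENNReal.rpow_mul, mul_comm (i : ℝ),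
          ENNReal.rpow_mul, ENNReal.rpow_natCast, hρ, ENNReal.inv_pow]
      split_ifs
      · rw [h2]
        gcongr
      · exact zero_le
    refine (ENNReal.tsum_le_tsum hterm).trans ?_
    rw [ENNReal.tsum_mul_left, ENNReal.tsum_geometric, mul_comm]
    gcongr
  · intro k hk
    have hk' : (2 : ℝ≥0∞) ^ k < y := by
      by_contra h
      simp [h] at hk
    exact ⟨(j - k).toNat, by
      have := hle k hk'
      simp only
      omega⟩

lemma rpow_le_tsum_zpow_rpow {θ : ℝ} (hθ : 0 < θ) (y : ℝ≥0∞) :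
    y ^ θ ≤ 2 ^ θ * ∑' k : ℤ, (if (2 : ℝ≥0∞) ^ k < y then ((2 : ℝ≥0∞) ^ k) ^ θ else 0) := by
  rcases eq_or_ne y 0 with rfl | h0
  · simp [hθ]
  rcases eq_or_ne y ∞ with rfl | htop
  · have h : (∑' k : ℤ, (if (2 : ℝ≥0∞) ^ k < ∞ then ((2 : ℝ≥0∞) ^ k) ^ θ else 0)) = ∞ := by
      rw [eq_top_iff]
      calc (∞ : ℝ≥0∞) = ∑' _ : ℕ, 1 := (ENNReal.tsum_const_eq_top_of_ne_zero one_ne_zero).symm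
        _ ≤ ∑' i : ℕ, (if (2 : ℝ≥0∞) ^ (i : ℤ) < ∞ then ((2 : ℝ≥0∞) ^ (i : ℤ)) ^ θ else 0) := by
            refine ENNReal.tsum_le_tsum fun i => ?_
            rw [if_pos (by simp)]
            refine ENNReal.one_le_rpow ?_ hθ
            rw [zpow_natCast]
            exact one_le_pow₀ (by norm_num)
        _ ≤ _ := ENNReal.tsum_comp_le_tsum_of_injective Nat.cast_injective
            (fun k : ℤ => if (2 : ℝ≥0∞) ^ k < ∞ then ((2 : ℝ≥0∞) ^ k) ^ θ else 0)
    rw [h, ENNReal.mul_top]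
    · exact le_top
    · simp
  obtain ⟨j, hj1, hj2⟩ := ENNReal.exists_mem_Ioc_zpow h0 htop (y := 2) (by norm_num) (by norm_num)
  calc y ^ θ ≤ ((2 : ℝ≥0∞) ^ (j + 1)) ^ θ := by gcongr
    _ = 2 ^ θ * (if (2 : ℝ≥0∞) ^ j < y then ((2 : ℝ≥0∞) ^ j) ^ θ else 0) := by
        rw [if_pos hj1, ENNReal.zpow_add (by norm_num) (by norm_num), mul_comm, zpow_one,
          ENNReal.mul_rpow_of_nonneg _ _ hθ.le]
    _ ≤ _ := by
        gcongr
        exact ENNReal.le_tsum (f := fun k : ℤ => if (2 : ℝ≥0∞) ^ k < y then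
          ((2 : ℝ≥0∞) ^ k) ^ θ else 0) j

/-! ### Hölder's inequality -/

lemma lintegral_le_rpow_mul_measure_rpow {α : Type*} [MeasurableSpace α] (μ : Measure α) {p : ℝ}
    (hp : 1 < p) {g : α → ℝ≥0∞} (hg : AEMeasurable g μ) :
    ∫⁻ y, g y ∂μ ≤ (∫⁻ y, g y ^ p ∂μ) ^ (1 / p) * μ univ ^ (1 - 1 / p) := by
  have hpq := Real.HolderConjugate.conjExponent hp
  have h := ENNReal.lintegral_mul_le_Lp_mul_Lq μ hpq hg (aemeasurable_const (b := (1 : ℝ≥0∞)))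
  simp only [Pi.mul_apply, mul_one, ENNReal.one_rpow, lintegral_one] at h
  convert h using 3
  have := hpq.inv_add_inv_eq_one
  rw [one_div, one_div]
  linarith

/-! ### The local fractional maximal function -/

/-- The local fractional maximal function of an extended nonnegative function. -/
noncomputable def gMax (a β : ℝ) (g : E n → ℝ≥0∞) (x : E n) : ℝ≥0∞ :=
  ⨆ (c : E n) (r : ℝ) (_ : Admissible a c r) (_ : x ∈ ball c r),
    (∫⁻ y in ball c r, g y ∂(gauss n)) / (gauss n (ball c r)) ^ (1 - β)

lemma fracMaximal_eq_gMax (a β : ℝ) (f : E n → ℝ) :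
    fracMaximal a β f = gMax a β (fun y => ‖f y‖ₑ) := rfl

lemma le_gMax {a β : ℝ} (g : E n → ℝ≥0∞) {c x : E n} {r : ℝ} (hr : Admissible a c r)
    (hx : x ∈ ball c r) :
    (∫⁻ y in ball c r, g y ∂(gauss n)) / (gauss n (ball c r)) ^ (1 - β) ≤ gMax a β g x :=
  le_iSup_of_le c <| le_iSup_of_le r <| le_iSup_of_le hr <| le_iSup_of_le hx le_rfl

lemma gMax_le_iff {a β : ℝ} {g : E n → ℝ≥0∞} {x : E n} {t : ℝ≥0∞} :
    gMax a β g x ≤ t ↔ ∀ c r, Admissible a c r → x ∈ ball c r →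
      (∫⁻ y in ball c r, g y ∂(gauss n)) / (gauss n (ball c r)) ^ (1 - β) ≤ t := by
  simp only [gMax, iSup_le_iff]

lemma lt_gMax_iff {a β : ℝ} {g : E n → ℝ≥0∞} {x : E n} {t : ℝ≥0∞} :
    t < gMax a β g x ↔ ∃ c r, Admissible a c r ∧ x ∈ ball c r ∧
      t < (∫⁻ y in ball c r, g y ∂(gauss n)) / (gauss n (ball c r)) ^ (1 - β) := by
  simp only [gMax, lt_iSup_iff, exists_prop]

/-- Superlevel sets are unions of open balls, so no regularity of `g` is required. -/
lemma measurable_gMax (a β : ℝ) (g : E n → ℝ≥0∞) : Measurable (gMax a β g) := by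
  refine measurable_of_Ioi fun t => IsOpen.measurableSet ?_
  have : gMax a β g ⁻¹' Ioi t = ⋃ (c : E n) (r : ℝ) (_ : Admissible a c r)
      (_ : t < (∫⁻ y in ball c r, g y ∂(gauss n)) / (gauss n (ball c r)) ^ (1 - β)),
        ball c r := by
    ext x
    simp only [mem_preimage, mem_Ioi, lt_gMax_iff, mem_iUnion, exists_prop]
    refine exists_congr fun c => exists_congr fun r => and_congr_right fun _ => and_comm
  rw [this]
  exact isOpen_iUnion fun c => isOpen_iUnion fun r => isOpen_iUnion fun _ =>
    isOpen_iUnion fun _ => isOpen_ball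

/-- Radii in `𝓑_A` are at most `A`, so Vitali applies; doubling is invoked in `𝓑_{5A}` because the
enlarged balls lie there. -/
lemma exists_mul_measure_biUnion_ball_le (n : ℕ) {A : ℝ} (hA : 0 < A) :
    ∃ D : ℝ≥0, 1 ≤ D ∧ ∀ (g : E n → ℝ≥0∞) (t : ℝ≥0∞) (F : Set (E n × ℝ)),
      (∀ p ∈ F, Admissible A p.1 p.2 ∧
        t * gauss n (ball p.1 p.2) ≤ ∫⁻ y in ball p.1 p.2, g y ∂(gauss n)) →
      t * gauss n (⋃ p ∈ F, ball p.1 p.2) ≤ D * ∫⁻ y, g y ∂(gauss n) := by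
  obtain ⟨D, hD1, hD⟩ := exists_gauss_ball_le n (A := 5 * A) (L := 5) (by positivity) (by norm_num)
  refine ⟨D, hD1, fun g t F hF => ?_⟩
  obtain ⟨u, huF, hu, hd, hc⟩ := exists_vitali_subfamily (F := F) (R := A)
    (fun p hp => ⟨(hF p hp).1.1, (hF p hp).1.le hA.le⟩)
  have : Countable u := hu.to_subtype
  have hsub : (⋃ p ∈ F, ball p.1 p.2) ⊆ ⋃ q ∈ u, ball q.1 (5 * q.2) := by
    refine iUnion₂_subset fun p hp => ?_
    obtain ⟨q, hq, hpq⟩ := hc p hp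
    exact hpq.trans (subset_biUnion_of_mem (u := fun q : E n × ℝ => ball q.1 (5 * q.2)) hq)
  calc t * gauss n (⋃ p ∈ F, ball p.1 p.2)
      ≤ t * ∑' q : u, gauss n (ball q.1.1 (5 * q.1.2)) := by
        gcongr
        exact (measure_mono hsub).trans (measure_biUnion_le _ hu _)
    _ ≤ t * ∑' q : u, D * gauss n (ball q.1.1 q.1.2) := by
        gcongr with q
        have hq := (hF _ (huF q.2)).1
        exact hD _ _ _ _ (hq.mul (by norm_num)) le_rfl
          (ball_subset_ball (by linarith [hq.1]))
    _ = D * ∑' q : u, t * gauss n (ball q.1.1 q.1.2) := by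
        rw [ENNReal.tsum_mul_left, ENNReal.tsum_mul_left]
        ring
    _ ≤ D * ∑' q : u, ∫⁻ y in ball q.1.1 q.1.2, g y ∂(gauss n) := by
        gcongr with q
        exact (hF _ (huF q.2)).2
    _ ≤ D * ∫⁻ y, g y ∂(gauss n) := by
        gcongr
        have := tsum_setLIntegral_le hu hd (s := univ) (fun _ _ => subset_univ _) g
        rwa [setLIntegral_univ] at this

lemma mul_le_of_lt_div {t I v : ℝ≥0∞} (h : t < I / v) : t * v ≤ I :=
  ENNReal.mul_le_of_le_div h.le

/-- Weak type inequality for the truncation of `g` at height `t / 2`. -/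
lemma exists_mul_measure_lt_gMax_le (n : ℕ) {A : ℝ} (hA : 0 < A) :
    ∃ D : ℝ≥0, 1 ≤ D ∧ ∀ (g : E n → ℝ≥0∞) (t : ℝ≥0∞), AEMeasurable g (gauss n) → t ≠ ∞ →
      t * gauss n {x | t < gMax A 0 g x} ≤
        2 * D * ∫⁻ y, (if t < 2 * g y then g y else 0) ∂(gauss n) := by
  obtain ⟨D, hD1, hD⟩ := exists_mul_measure_biUnion_ball_le n hA
  refine ⟨D, hD1, fun g t hg ht => ?_⟩
  set G : E n → ℝ≥0∞ := fun y => if t < 2 * g y then g y else 0 with hG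
  set F : Set (E n × ℝ) := {p | Admissible A p.1 p.2 ∧
    t * gauss n (ball p.1 p.2) ≤ ∫⁻ y in ball p.1 p.2, g y ∂(gauss n)} with hF
  have hsub : {x | t < gMax A 0 g x} ⊆ ⋃ p ∈ F, ball p.1 p.2 := by
    intro x hx
    obtain ⟨c, r, hr, hxr, hlt⟩ := lt_gMax_iff.1 hx
    rw [sub_zero, ENNReal.rpow_one] at hlt
    exact mem_biUnion (x := (c, r)) ⟨hr, mul_le_of_lt_div hlt⟩ hxr
  have hFG : ∀ p ∈ F, Admissible A p.1 p.2 ∧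
      t / 2 * gauss n (ball p.1 p.2) ≤ ∫⁻ y in ball p.1 p.2, G y ∂(gauss n) := by
    intro p hp
    refine ⟨hp.1, ?_⟩
    -- The discarded part of `g` is at most `t / 2`, so a ball on which `g` has mean at least `t`
    -- still has mean at least `t / 2` for `G`.
    have h1 : ∀ y, g y ≤ G y + t / 2 := by
      intro y
      simp only [hG]
      split_ifs with h
      · exact le_self_add
      · rw [zero_add, ENNReal.le_div_iff_mul_le (by simp) (by simp), mul_comm]
        exact not_lt.1 h
    have h2 : ∫⁻ y in ball p.1 p.2, g y ∂(gauss n) ≤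
        ∫⁻ y in ball p.1 p.2, G y ∂(gauss n) + t / 2 * gauss n (ball p.1 p.2) := by
      refine (lintegral_mono h1).trans ?_
      rw [lintegral_add_right _ measurable_const, setLIntegral_const]
    have h3 : t * gauss n (ball p.1 p.2) =
        t / 2 * gauss n (ball p.1 p.2) + t / 2 * gauss n (ball p.1 p.2) := by
      rw [← add_mul, ENNReal.add_halves]
    have h4 := hp.2.trans h2
    rw [h3] at h4
    exact (ENNReal.add_le_add_iff_right
      (ENNReal.mul_ne_top (ENNReal.div_ne_top ht (by simp)) (measure_ne_top _ _))).1 h4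
  have h5 := hD G (t / 2) F hFG
  calc t * gauss n {x | t < gMax A 0 g x} ≤ t * gauss n (⋃ p ∈ F, ball p.1 p.2) := by
        gcongr
    _ = 2 * (t / 2 * gauss n (⋃ p ∈ F, ball p.1 p.2)) := by
        rw [← mul_assoc, ENNReal.mul_div_cancel (by simp) (by simp)]
    _ ≤ 2 * (D * ∫⁻ y, G y ∂(gauss n)) := by gcongr
    _ = _ := by rw [mul_assoc]

/-- The local maximal operator is bounded on `L^p` for `p > 1`. -/
lemma exists_lintegral_gMax_zero_rpow_le (n : ℕ) {A p : ℝ} (hA : 0 < A) (hp : 1 < p) :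
    ∃ C : ℝ≥0, 0 < C ∧ ∀ g : E n → ℝ≥0∞, AEMeasurable g (gauss n) →
      ∫⁻ x, gMax A 0 g x ^ p ∂(gauss n) ≤ C * ∫⁻ x, g x ^ p ∂(gauss n) := by
  obtain ⟨D, hD1, hD⟩ := exists_mul_measure_lt_gMax_le n hA
  obtain ⟨C, hC0, hC⟩ := exists_tsum_zpow_rpow_le (θ := p - 1) (by linarith)
  have hp0 : 0 < p := by linarith
  refine ⟨2 ^ p * (2 * D) * (C * 2 ^ (p - 1)), by positivity, fun g hg => ?_⟩
  have hms : ∀ k : ℤ, MeasurableSet {x : E n | (2 : ℝ≥0∞) ^ k < gMax A 0 g x} := fun k =>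
    measurableSet_lt measurable_const (measurable_gMax A 0 g)
  -- One factor `2 ^ k` of `(2 ^ k) ^ p` is spent on the weak type inequality. The remaining
  -- exponent `p - 1` is positive, which makes the later sum over `k` comparable to `g ^ (p - 1)`.
  have hterm : ∀ k : ℤ, ∫⁻ x, (if (2 : ℝ≥0∞) ^ k < gMax A 0 g x then
      ((2 : ℝ≥0∞) ^ k) ^ p else 0) ∂(gauss n) ≤
      2 * D * ∫⁻ y, g y * (if (2 : ℝ≥0∞) ^ k < 2 * g y then
        ((2 : ℝ≥0∞) ^ k) ^ (p - 1) else 0) ∂(gauss n) := by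
    intro k
    have h2k : ((2 : ℝ≥0∞) ^ k) ≠ ∞ := ENNReal.zpow_ne_top (by simp) (by simp) k
    have h1 : ∫⁻ x, (if (2 : ℝ≥0∞) ^ k < gMax A 0 g x then
        ((2 : ℝ≥0∞) ^ k) ^ p else 0) ∂(gauss n) =
        ((2 : ℝ≥0∞) ^ k) ^ p * gauss n {x : E n | (2 : ℝ≥0∞) ^ k < gMax A 0 g x} := by
      rw [← lintegral_indicator_const (hms k)]
      simp only [indicator, mem_ofPred_eq]
    have h2 : ((2 : ℝ≥0∞) ^ k) ^ p = ((2 : ℝ≥0∞) ^ k) ^ (p - 1) * (2 : ℝ≥0∞) ^ k := by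
      conv_rhs => rw [← ENNReal.rpow_one ((2 : ℝ≥0∞) ^ k), ← ENNReal.rpow_mul, one_mul]
      rw [← ENNReal.rpow_add_of_nonneg _ _ (by linarith) zero_le_one]
      simp
    rw [h1, h2, mul_assoc]
    calc ((2 : ℝ≥0∞) ^ k) ^ (p - 1) *
          ((2 : ℝ≥0∞) ^ k * gauss n {x : E n | (2 : ℝ≥0∞) ^ k < gMax A 0 g x})
        ≤ ((2 : ℝ≥0∞) ^ k) ^ (p - 1) *
          (2 * D * ∫⁻ y, (if (2 : ℝ≥0∞) ^ k < 2 * g y then g y else 0) ∂(gauss n)) := by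
          exact mul_le_mul' le_rfl (hD g _ hg h2k)
      _ = 2 * D * (((2 : ℝ≥0∞) ^ k) ^ (p - 1) *
          ∫⁻ y, (if (2 : ℝ≥0∞) ^ k < 2 * g y then g y else 0) ∂(gauss n)) := by ring
      _ = _ := by
          rw [← lintegral_const_mul' _ _
            (ENNReal.rpow_ne_top_of_nonneg (by linarith) h2k)]
          congr 2
          ext y
          split_ifs <;> simp [mul_comm]
  have hmeas : ∀ k : ℤ, AEMeasurable (fun y => g y * (if (2 : ℝ≥0∞) ^ k < 2 * g y then
        ((2 : ℝ≥0∞) ^ k) ^ (p - 1) else 0)) (gauss n) := by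
    intro k
    have : Measurable (fun z : ℝ≥0∞ => z * (if (2 : ℝ≥0∞) ^ k < 2 * z then
        ((2 : ℝ≥0∞) ^ k) ^ (p - 1) else 0)) := by
      refine measurable_id.mul (Measurable.ite ?_ measurable_const measurable_const)
      exact measurableSet_lt measurable_const (measurable_id.const_mul 2)
    exact this.comp_aemeasurable hg
  calc ∫⁻ x, gMax A 0 g x ^ p ∂(gauss n)
      ≤ ∫⁻ x, 2 ^ p * ∑' k : ℤ, (if (2 : ℝ≥0∞) ^ k < gMax A 0 g x then
        ((2 : ℝ≥0∞) ^ k) ^ p else 0) ∂(gauss n) :=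
        lintegral_mono fun x => rpow_le_tsum_zpow_rpow hp0 _
    _ = 2 ^ p * ∑' k : ℤ, ∫⁻ x, (if (2 : ℝ≥0∞) ^ k < gMax A 0 g x then
        ((2 : ℝ≥0∞) ^ k) ^ p else 0) ∂(gauss n) := by
        rw [lintegral_const_mul', lintegral_tsum]
        · exact fun k => (Measurable.ite (hms k) measurable_const measurable_const).aemeasurable
        · exact ENNReal.rpow_ne_top_of_nonneg hp0.le (by simp)
    _ ≤ 2 ^ p * ∑' k : ℤ, 2 * D * ∫⁻ y, g y * (if (2 : ℝ≥0∞) ^ k < 2 * g y then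
        ((2 : ℝ≥0∞) ^ k) ^ (p - 1) else 0) ∂(gauss n) := by
        gcongr with k
        exact hterm k
    _ = 2 ^ p * (2 * D) * ∫⁻ y, g y * ∑' k : ℤ, (if (2 : ℝ≥0∞) ^ k < 2 * g y then
        ((2 : ℝ≥0∞) ^ k) ^ (p - 1) else 0) ∂(gauss n) := by
        rw [ENNReal.tsum_mul_left, ← lintegral_tsum hmeas, ← mul_assoc]
        simp only [ENNReal.tsum_mul_left]
    _ ≤ 2 ^ p * (2 * D) * ∫⁻ y, (C * 2 ^ (p - 1)) * g y ^ p ∂(gauss n) := by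
        refine mul_le_mul' le_rfl (lintegral_mono fun y => ?_)
        calc g y * _ ≤ g y * (C * (2 * g y) ^ (p - 1)) := by
              gcongr
              exact hC _
          _ = (C * 2 ^ (p - 1)) * (g y ^ (1 : ℝ) * g y ^ (p - 1)) := by
              rw [ENNReal.mul_rpow_of_nonneg _ _ (by linarith), ENNReal.rpow_one]
              ring
          _ = _ := by
              rw [← ENNReal.rpow_add_of_nonneg _ _ zero_le_one (by linarith)]
              simp
    _ = _ := by
        have h2p : (2 : ℝ≥0∞) ^ (p - 1) ≠ ∞ := ENNReal.rpow_ne_top_of_nonneg (by linarith) (by simp)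
        rw [lintegral_const_mul' _ _ (ENNReal.mul_ne_top (by simp) h2p), ← mul_assoc]
        push_cast
        rw [ENNReal.coe_rpow_of_nonneg _ hp0.le, ENNReal.coe_rpow_of_nonneg _ (by linarith)]
        simp

/-- Hedberg's pointwise inequality. -/
lemma gMax_le_rpow_mul {a β p q : ℝ} (hβ0 : 0 ≤ β) (hp : 1 < p) (hq : 0 < q)
    (hβ : 1 / q = 1 / p - β) {g : E n → ℝ≥0∞} (hg : AEMeasurable g (gauss n)) (x : E n) :
    gMax a β g x ≤ gMax a 0 g x ^ (p / q) * (∫⁻ y, g y ^ p ∂(gauss n)) ^ β := by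
  rw [gMax_le_iff]
  intro c r hr hx
  set v := gauss n (ball c r) with hv
  set J := ∫⁻ y in ball c r, g y ∂(gauss n) with hJ
  set I := ∫⁻ y, g y ^ p ∂(gauss n) with hI
  set M := gMax a 0 g x with hM
  have hv0 : v ≠ 0 := gauss_ball_ne_zero c hr.1
  have hvt : v ≠ ∞ := measure_ne_top _ _
  have hp0 : 0 < p := by linarith
  have h1 : J ≤ M * v := by
    have := le_gMax (β := 0) g hr hx
    rw [sub_zero, ENNReal.rpow_one] at this
    exact (ENNReal.div_le_iff hv0 hvt).1 this
  have h2 : J ≤ I ^ (1 / p) * v ^ (1 - 1 / p) := by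
    refine (lintegral_le_rpow_mul_measure_rpow _ hp hg.restrict).trans ?_
    rw [Measure.restrict_apply_univ]
    gcongr
    exact setLIntegral_le_lintegral _ _
  -- `J` is written as `J ^ (p / q) * J ^ (β * p)`, with the maximal bound used in the first factor
  -- and Hölder in the second. The powers of `v` then add up to `1 - β`.
  have he : p / q + β * p = 1 := by
    have : p / q = p * (1 / q) := by ring
    rw [this, hβ]
    field_simp
    ring
  refine ENNReal.div_le_of_le_mul ?_
  calc J = J ^ (p / q) * J ^ (β * p) := by
        rw [← ENNReal.rpow_add_of_nonneg _ _ (by positivity) (by positivity), he, ENNReal.rpow_one]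
    _ ≤ (M * v) ^ (p / q) * (I ^ (1 / p) * v ^ (1 - 1 / p)) ^ (β * p) := by
        gcongr
    _ = M ^ (p / q) * I ^ β * (v ^ (p / q) * v ^ ((1 - 1 / p) * (β * p))) := by
        rw [ENNReal.mul_rpow_of_nonneg _ _ (by positivity),
          ENNReal.mul_rpow_of_nonneg _ _ (by positivity), ← ENNReal.rpow_mul, ← ENNReal.rpow_mul]
        have : 1 / p * (β * p) = β := by field_simp
        rw [this]
        ring
    _ = M ^ (p / q) * I ^ β * v ^ (1 - β) := by
        rw [← ENNReal.rpow_add _ _ hv0 hvt]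
        congr 2
        have : (1 - 1 / p) * (β * p) = β * p - β := by field_simp
        rw [this]
        linarith

/-- The local fractional maximal operator is bounded from `L^p` to `L^q`. -/
lemma exists_lintegral_gMax_rpow_le (n : ℕ) {a β p q : ℝ} (ha : 0 < a) (hβ0 : 0 ≤ β) (hp : 1 < p)
    (hq : 0 < q) (hβ : 1 / q = 1 / p - β) :
    ∃ C : ℝ≥0, 0 < C ∧ ∀ g : E n → ℝ≥0∞, AEMeasurable g (gauss n) →
      ∫⁻ x, gMax a β g x ^ q ∂(gauss n) ≤ C * (∫⁻ x, g x ^ p ∂(gauss n)) ^ (q / p) := by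
  obtain ⟨C, hC0, hC⟩ := exists_lintegral_gMax_zero_rpow_le n ha hp
  refine ⟨C, hC0, fun g hg => ?_⟩
  set I := ∫⁻ y, g y ^ p ∂(gauss n) with hI
  have hp0 : 0 < p := by linarith
  have he : 1 + β * q = q / p := by
    have : q / p = q * (1 / p) := by ring
    rw [this, show 1 / p = 1 / q + β by linarith]
    field_simp
  calc ∫⁻ x, gMax a β g x ^ q ∂(gauss n)
      ≤ ∫⁻ x, gMax a 0 g x ^ p * I ^ (β * q) ∂(gauss n) := by
        refine lintegral_mono fun x => ?_
        refine (ENNReal.rpow_le_rpow (gMax_le_rpow_mul hβ0 hp hq hβ hg x) hq.le).trans_eq ?_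
        rw [ENNReal.mul_rpow_of_nonneg _ _ hq.le, ← ENNReal.rpow_mul, ← ENNReal.rpow_mul,
          div_mul_cancel₀ _ hq.ne']
    _ = (∫⁻ x, gMax a 0 g x ^ p ∂(gauss n)) * I ^ (β * q) :=
        lintegral_mul_const _ ((measurable_gMax a 0 g).pow_const p)
    _ ≤ C * I * I ^ (β * q) := by
        gcongr
        exact hC g hg
    _ = C * I ^ (q / p) := by
        rw [← he, ENNReal.rpow_add_of_nonneg _ _ zero_le_one (by positivity), ENNReal.rpow_one,
          mul_assoc]

/-! ### Mean oscillations -/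

/-- The `s`-th power mean oscillation of `b` over the balls of `𝓑_δ` is at most `T`. -/
def OscBound (b : E n → ℝ) (s δ : ℝ) (T : ℝ≥0∞) : Prop :=
  ∀ (c : E n) (r : ℝ), Admissible δ c r →
    ∫⁻ y in ball c r, ‖b y - ballAvg b c r‖ₑ ^ s ∂(gauss n) ≤ T * gauss n (ball c r)

lemma OscBound.mono {b : E n → ℝ} {s δ δ' : ℝ} {T T' : ℝ≥0∞} (h : OscBound b s δ T) (hδ : δ' ≤ δ)
    (hT : T ≤ T') : OscBound b s δ' T' :=
  fun c r hr => (h c r (hr.mono hδ)).trans (by gcongr)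

lemma enorm_ballAvg_sub_le {b : E n → ℝ} (hb : Integrable b (gauss n)) {κ : ℝ} {c : E n} {r : ℝ}
    (hr : 0 < r) {t : ℝ≥0∞}
    (h : ∫⁻ y in ball c r, ‖b y - κ‖ₑ ∂(gauss n) ≤ t * gauss n (ball c r)) :
    ‖ballAvg b c r - κ‖ₑ ≤ t :=
  (ENNReal.mul_le_mul_iff_left (gauss_ball_ne_zero c hr) (measure_ne_top _ _)).1
    ((enorm_ballAvg_sub_mul_le hb κ c r).trans h)

lemma lintegral_le_of_lintegral_rpow_le {α : Type*} [MeasurableSpace α] {μ : Measure α}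
    (hμ0 : μ univ ≠ 0) (hμ : μ univ ≠ ∞) {s : ℝ} (hs : 1 ≤ s) {g : α → ℝ≥0∞} (hg : AEMeasurable g μ)
    {X : ℝ≥0∞} (h : ∫⁻ y, g y ^ s ∂μ ≤ X * μ univ) :
    ∫⁻ y, g y ∂μ ≤ X ^ (1 / s) * μ univ := by
  rcases hs.eq_or_lt with rfl | hs1
  · simpa using h
  · have hs0 : 0 < s := by linarith
    refine (lintegral_le_rpow_mul_measure_rpow μ hs1 hg).trans ?_
    calc (∫⁻ y, g y ^ s ∂μ) ^ (1 / s) * μ univ ^ (1 - 1 / s)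
        ≤ (X * μ univ) ^ (1 / s) * μ univ ^ (1 - 1 / s) := by gcongr
      _ = X ^ (1 / s) * (μ univ ^ (1 / s) * μ univ ^ (1 - 1 / s)) := by
          rw [ENNReal.mul_rpow_of_nonneg _ _ (by positivity), mul_assoc]
      _ = X ^ (1 / s) * μ univ := by
          rw [← ENNReal.rpow_add _ _ hμ0 hμ]
          simp

/-- By Hölder `|κ - b_B| ^ s ≤ X`, so passing from any reference constant to the mean costs only `2
^ s`. -/
lemma lintegral_enorm_sub_ballAvg_rpow_le {b : E n → ℝ} (hb : Integrable b (gauss n)) {s : ℝ}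
    (hs : 1 ≤ s) {κ : ℝ} {c : E n} {r : ℝ} (hr : 0 < r) {X : ℝ≥0∞}
    (h : ∫⁻ y in ball c r, ‖b y - κ‖ₑ ^ s ∂(gauss n) ≤ X * gauss n (ball c r)) :
    ∫⁻ y in ball c r, ‖b y - ballAvg b c r‖ₑ ^ s ∂(gauss n) ≤
      2 ^ (s - 1) * (2 * X) * gauss n (ball c r) := by
  have hs0 : 0 < s := by linarith
  have h1 : ∫⁻ y in ball c r, ‖b y - κ‖ₑ ∂(gauss n) ≤ X ^ (1 / s) * gauss n (ball c r) := by
    have := lintegral_le_of_lintegral_rpow_le (μ := (gauss n).restrict (ball c r))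
      (by simpa using gauss_ball_ne_zero c hr) (by simp) hs
      (aemeasurable_enorm_sub hb κ).restrict (X := X) (by simpa using h)
    simpa using this
  have h2 : ‖κ - ballAvg b c r‖ₑ ^ s ≤ X := by
    rw [← enorm_neg, neg_sub]
    calc _ ≤ (X ^ (1 / s)) ^ s := by
          gcongr
          exact enorm_ballAvg_sub_le hb hr h1
      _ = X := by rw [← ENNReal.rpow_mul, one_div_mul_cancel hs0.ne', ENNReal.rpow_one]
  calc ∫⁻ y in ball c r, ‖b y - ballAvg b c r‖ₑ ^ s ∂(gauss n)
      ≤ ∫⁻ y in ball c r, 2 ^ (s - 1) * (‖b y - κ‖ₑ ^ s + X) ∂(gauss n) := by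
        refine lintegral_mono fun y => ?_
        refine (ENNReal.rpow_le_rpow (enorm_sub_le_add _ κ _) hs0.le).trans ?_
        refine (ENNReal.rpow_add_le_mul_rpow_add_rpow _ _ hs).trans ?_
        gcongr
    _ = 2 ^ (s - 1) * (∫⁻ y in ball c r, ‖b y - κ‖ₑ ^ s ∂(gauss n) + X * gauss n (ball c r)) := by
        rw [lintegral_const_mul' _ _ (ENNReal.rpow_ne_top_of_nonneg (by linarith) (by simp)),
          lintegral_add_right _ measurable_const, setLIntegral_const]
    _ ≤ 2 ^ (s - 1) * (X * gauss n (ball c r) + X * gauss n (ball c r)) := by gcongr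
    _ = _ := by ring

/-! ### The John–Nirenberg inequality -/

/-- A Calderón–Zygmund covering of the set where `h` exceeds a large multiple of its mean value
over a ball. -/
lemma exists_calderonZygmund_covering (n : ℕ) : ∃ D : ℝ≥0, 1 ≤ D ∧
    ∀ (h : E n → ℝ≥0∞), AEMeasurable h (gauss n) → ∫⁻ y, h y ∂(gauss n) ≠ ∞ →
    ∀ (c : E n) (r : ℝ) (t l : ℝ≥0∞), Admissible (1 / 2) c r →
      ∫⁻ y in ball c (2 * r), h y ∂(gauss n) ≤ t * gauss n (ball c r) → D * t ≤ l →
      ∃ u : Set (E n × ℝ), u.Countable ∧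
        (∀ p ∈ u, Admissible (1 / 2) p.1 p.2 ∧
          ∫⁻ y in ball p.1 p.2, h y ∂(gauss n) ≤ l * gauss n (ball p.1 p.2)) ∧
        l * ∑' p : u, gauss n (ball p.1.1 p.1.2) ≤ D * t * gauss n (ball c r) ∧
        ∀ᵐ x ∂(gauss n), x ∈ ball c r → l < h x → ∃ p ∈ u, x ∈ ball p.1 p.2 := by
  obtain ⟨D, hD1, hD⟩ := exists_gauss_ball_le n (A := 1) (L := 10) one_pos (by norm_num)
  refine ⟨D, hD1, fun h hh hfin c r t l hr ht hl => ?_⟩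
  have hr0 := hr.1
  -- Balls of radius between `r / 5` and `r` are comparable with the doubled ball, so their means do
  -- not exceed `l`: the stopping radius below must be at most `r / 25`.
  have hbig : ∀ x ∈ ball c r, ∀ ρ, ρ ≤ r → r / 5 ≤ ρ →
      ∫⁻ y in ball x ρ, h y ∂(gauss n) ≤ l * gauss n (ball x ρ) := by
    intro x hx ρ hρ hρ'
    have hsub : ball x ρ ⊆ ball c (2 * r) :=
      ball_subset_ball' (by linarith [mem_ball.1 hx])
    calc ∫⁻ y in ball x ρ, h y ∂(gauss n) ≤ ∫⁻ y in ball c (2 * r), h y ∂(gauss n) :=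
          lintegral_mono_set hsub
      _ ≤ t * gauss n (ball c (2 * r)) := by
          refine ht.trans ?_
          gcongr
          linarith
      _ ≤ t * (D * gauss n (ball x ρ)) := by
          gcongr
          refine hD _ _ _ _ ?_ (by linarith) hsub
          simpa using hr.mul (l := 2) (by norm_num)
      _ = D * t * gauss n (ball x ρ) := by ring
      _ ≤ l * gauss n (ball x ρ) := by gcongr
  -- Stopping balls: the mean is at least `l` here and at most `l` on the fivefold ball. The
  -- fivefold balls are the ones returned; they cover and still have controlled mean.
  set F : Set (E n × ℝ) := {p | p.1 ∈ ball c r ∧ 0 < p.2 ∧ p.2 ≤ r / 25 ∧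
    l * gauss n (ball p.1 p.2) ≤ ∫⁻ y in ball p.1 p.2, h y ∂(gauss n) ∧
    ∫⁻ y in ball p.1 (5 * p.2), h y ∂(gauss n) ≤ l * gauss n (ball p.1 (5 * p.2))} with hF
  -- The fivefold radius is at most `r / 5`, which outweighs the loss `3 / 2` in changing centre.
  -- The new balls therefore stay in `𝓑_{1/2}`, as the self-improving estimate of `J` below
  -- requires.
  have hadm : ∀ p ∈ F, Admissible (1 / 2) p.1 (5 * p.2) := by
    rintro p ⟨hp1, hp2, hp3, -, -⟩
    refine ⟨by linarith, ?_⟩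
    have h1 : m c ≤ (1 + 1 / 2) * m p.1 :=
      m_le_mul_m (by norm_num) ((mem_ball.1 hp1).le.trans hr.2)
    have h2 := hr.2
    have h3 := m_pos p.1
    linarith
  obtain ⟨u, huF, hu, hd, hc⟩ := exists_vitali_subfamily (F := F) (R := r / 25)
    (fun p hp => ⟨hp.2.1, hp.2.2.1⟩)
  have hinj : Function.Injective (fun p : E n × ℝ => (p.1, 5 * p.2)) := by
    rintro ⟨x, ρ⟩ ⟨x', ρ'⟩ hxx
    simpa using hxx
  refine ⟨(fun p : E n × ℝ => (p.1, 5 * p.2)) '' u, hu.image _, ?_, ?_, ?_⟩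
  · rintro _ ⟨p, hp, rfl⟩
    exact ⟨hadm p (huF hp), (huF hp).2.2.2.2⟩
  · rw [tsum_image (fun p : E n × ℝ => gauss n (ball p.1 p.2)) hinj.injOn]
    calc l * ∑' p : u, gauss n (ball p.1.1 (5 * p.1.2))
        ≤ l * ∑' p : u, D * gauss n (ball p.1.1 p.1.2) := by
          gcongr with p
          have hp := huF p.2
          refine hD _ _ _ _ ((hadm _ hp).mono (by norm_num)) (by linarith [hp.2.1])
            (ball_subset_ball (by linarith [hp.2.1]))
      _ = D * ∑' p : u, l * gauss n (ball p.1.1 p.1.2) := by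
          rw [ENNReal.tsum_mul_left, ENNReal.tsum_mul_left]
          ring
      _ ≤ D * ∑' p : u, ∫⁻ y in ball p.1.1 p.1.2, h y ∂(gauss n) := by
          gcongr with p
          exact (huF p.2).2.2.2.1
      _ ≤ D * ∫⁻ y in ball c (2 * r), h y ∂(gauss n) := by
          gcongr
          refine tsum_setLIntegral_le hu hd (fun p hp => ?_) h
          have hp := huF hp
          exact ball_subset_ball' (by linarith [mem_ball.1 hp.1, hp.2.2.1])
      _ ≤ D * t * gauss n (ball c r) := by
          rw [mul_assoc]
          gcongr
  · filter_upwards [ae_tendsto_lintegral_ball_div hh hfin] with x hx hxc hlx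
    have hseq : Tendsto (fun k : ℕ => r * (1 / 5 : ℝ) ^ k) atTop (𝓝[>] 0) := by
      refine tendsto_nhdsWithin_iff.2 ⟨?_, Eventually.of_forall fun k => ?_⟩
      · simpa using (tendsto_pow_atTop_nhds_zero_of_lt_one (r := (1 / 5 : ℝ)) (by norm_num)
          (by norm_num)).const_mul r
      · exact mul_pos hr0 (by positivity)
    have hex : ∃ k : ℕ, l * gauss n (ball x (r * (1 / 5 : ℝ) ^ k)) <
        ∫⁻ y in ball x (r * (1 / 5 : ℝ) ^ k), h y ∂(gauss n) := by
      obtain ⟨k, hk⟩ := ((hx.comp hseq).eventually (lt_mem_nhds hlx)).exists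
      refine ⟨k, ?_⟩
      have hpos : 0 < r * (1 / 5 : ℝ) ^ k := by positivity
      exact (ENNReal.lt_div_iff_mul_lt (Or.inl (gauss_ball_ne_zero x hpos))
        (Or.inl (measure_ne_top _ _))).1 hk
    -- The stopping index is the first `k` at which the mean over the ball of radius `r / 5 ^ k`
    -- exceeds `l`; minimality gives the opposite bound at five times that radius.
    classical
    set k := Nat.find hex with hk
    have hk1 := Nat.find_spec hex
    rw [← hk] at hk1
    have hk2 : 2 ≤ k := by
      by_contra hlt
      have : k = 0 ∨ k = 1 := by omega
      refine absurd hk1 (not_lt.2 (hbig x hxc _ ?_ ?_)) <;> rcases this with h0 | h0 <;> rw [h0] <;>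
        norm_num <;> linarith
    have hk3 := Nat.find_min hex (m := k - 1) (by omega)
    have hk4 : r * (1 / 5 : ℝ) ^ (k - 1) = 5 * (r * (1 / 5 : ℝ) ^ k) := by
      obtain ⟨j, hj⟩ : ∃ j, k = j + 1 := ⟨k - 1, by omega⟩
      rw [hj, Nat.add_sub_cancel, pow_succ]
      ring
    rw [hk4, not_lt] at hk3
    have hpF : (x, r * (1 / 5 : ℝ) ^ k) ∈ F := by
      refine ⟨hxc, by positivity, ?_, hk1.le, hk3⟩
      have : (1 / 5 : ℝ) ^ k ≤ (1 / 5) ^ 2 := pow_le_pow_of_le_one (by norm_num) (by norm_num) hk2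
      simp only
      nlinarith
    obtain ⟨q, hq, hsub⟩ := hc _ hpF
    exact ⟨_, mem_image_of_mem _ hq, hsub (mem_ball_self (by positivity))⟩

/-- Power mean oscillations are controlled by mean oscillations. -/
lemma exists_oscBound_rpow (n : ℕ) {s : ℝ} (hs : 1 ≤ s) :
    ∃ C : ℝ≥0, ∀ (b : E n → ℝ) (t : ℝ≥0∞), Integrable b (gauss n) → t ≠ 0 → t ≠ ∞ →
      OscBound b 1 1 t → OscBound b s (1 / 2) (C * t ^ s) := by
  have hs0 : 0 < s := by linarith
  obtain ⟨D, hD1, hD⟩ := exists_calderonZygmund_covering n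
  obtain ⟨D', hD'1, hD'⟩ := exists_gauss_ball_le n (A := 1) (L := 2) one_pos (by norm_num)
  set c₀ : ℝ≥0 := 2 ^ (s - 1) with hc₀
  have hc₀1 : 1 ≤ c₀ := NNReal.one_le_rpow (by norm_num) (by linarith)
  have hc₀' : (2 : ℝ≥0∞) ^ (s - 1) = c₀ := by
    rw [hc₀, ENNReal.coe_rpow_of_nonneg _ (by linarith)]
    rfl
  -- `D' (1 + D') t` bounds the integral of `|b - b_B|` over the doubled ball, relative to `γ(B)`;
  -- `D` comes from the covering; the factor `2 c₀` limits the total mass of the stopping balls to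
  -- `γ(B) / (2 c₀)`.
  set Λ : ℝ≥0 := 2 * c₀ * (D * (D' * (1 + D'))) with hΛ
  refine ⟨3 * Λ ^ s, fun b t hb ht0 ht hosc => ?_⟩
  set l : ℝ≥0∞ := Λ * t with hl
  have hl' : ((3 * Λ ^ s : ℝ≥0) : ℝ≥0∞) * t ^ s = 3 * l ^ s := by
    rw [hl, ENNReal.mul_rpow_of_nonneg _ _ hs0.le, ← ENNReal.coe_rpow_of_nonneg _ hs0.le]
    push_cast
    ring
  have hltop : l ≠ ∞ := ENNReal.mul_ne_top (by simp) ht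
  rw [hl']
  -- truncated oscillations
  have key : ∀ N : ℕ, ∀ (c : E n) (r : ℝ), Admissible (1 / 2) c r →
      ∫⁻ y in ball c r, (min ‖b y - ballAvg b c r‖ₑ N) ^ s ∂(gauss n) ≤
        3 * l ^ s * gauss n (ball c r) := by
    intro N
    -- `J` is the best constant for the truncated oscillations. Truncation at `N` makes it finite,
    -- so it can be absorbed, and the bound obtained does not depend on `N`.
    set J : ℝ≥0∞ := ⨆ (c : E n) (r : ℝ) (_ : Admissible (1 / 2) c r),
      (∫⁻ y in ball c r, (min ‖b y - ballAvg b c r‖ₑ N) ^ s ∂(gauss n)) / gauss n (ball c r)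
      with hJ
    have hJle : ∀ (c : E n) (r : ℝ), Admissible (1 / 2) c r →
        ∫⁻ y in ball c r, (min ‖b y - ballAvg b c r‖ₑ N) ^ s ∂(gauss n) ≤
          J * gauss n (ball c r) := by
      intro c r hr
      rw [← ENNReal.div_le_iff (gauss_ball_ne_zero c hr.1) (measure_ne_top _ _)]
      exact le_iSup_of_le c <| le_iSup_of_le r <| le_iSup_of_le hr le_rfl
    have hJtop : J ≠ ∞ := by
      have : J ≤ (N : ℝ≥0∞) ^ s := by
        refine iSup_le fun c => iSup_le fun r => iSup_le fun hr => ?_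
        refine ENNReal.div_le_of_le_mul ?_
        rw [← setLIntegral_const]
        refine lintegral_mono fun y => ?_
        gcongr
        exact min_le_right _ _
      exact ne_top_of_le_ne_top (ENNReal.rpow_ne_top_of_nonneg hs0.le (by simp)) this
    -- Outside the stopping balls `|b - κ| ≤ l` almost everywhere. On each of them the local mean is
    -- within `l` of `κ`, so the integral is at most `c₀ (J + l ^ s)` times its measure. Balls of
    -- `𝓑_{1/2}` are used so that their doubles lie in `𝓑_1`.
    have step : ∀ (c : E n) (r : ℝ), Admissible (1 / 2) c r →
        2 * ∫⁻ y in ball c r, (min ‖b y - ballAvg b c r‖ₑ N) ^ s ∂(gauss n) ≤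
          (3 * l ^ s + J) * gauss n (ball c r) := by
      intro c r hr
      have hr0 := hr.1
      have hr2 : Admissible 1 c (2 * r) := by simpa using hr.mul (l := 2) (by norm_num)
      set κ := ballAvg b c r with hκ
      have hsub : ball c r ⊆ ball c (2 * r) := ball_subset_ball (by linarith)
      have hγ2 : gauss n (ball c (2 * r)) ≤ D' * gauss n (ball c r) :=
        hD' _ _ _ _ hr2 le_rfl hsub
      have hosc2 : ∫⁻ y in ball c (2 * r), ‖b y - ballAvg b c (2 * r)‖ₑ ∂(gauss n) ≤
          t * gauss n (ball c (2 * r)) := by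
        simpa using hosc c (2 * r) hr2
      have hκ2 : ‖κ - ballAvg b c (2 * r)‖ₑ ≤ t * D' := by
        refine enorm_ballAvg_sub_le hb hr0 ((lintegral_mono_set hsub).trans (hosc2.trans ?_))
        rw [mul_assoc]
        gcongr
      have hint : ∫⁻ y in ball c (2 * r), ‖b y - κ‖ₑ ∂(gauss n) ≤
          (D' * (1 + D') * t) * gauss n (ball c r) := by
        calc ∫⁻ y in ball c (2 * r), ‖b y - κ‖ₑ ∂(gauss n)
            ≤ ∫⁻ y in ball c (2 * r), (‖b y - ballAvg b c (2 * r)‖ₑ + t * D') ∂(gauss n) := by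
              refine lintegral_mono fun y => (enorm_sub_le_add _ (ballAvg b c (2 * r)) _).trans ?_
              gcongr
              rwa [← enorm_neg, neg_sub]
          _ = ∫⁻ y in ball c (2 * r), ‖b y - ballAvg b c (2 * r)‖ₑ ∂(gauss n) +
              t * D' * gauss n (ball c (2 * r)) := by
              rw [lintegral_add_right _ measurable_const, setLIntegral_const]
          _ ≤ t * (D' * gauss n (ball c r)) + t * D' * (D' * gauss n (ball c r)) := by
              gcongr
              exact hosc2.trans (by gcongr)
          _ = _ := by ring
      set K : ℝ≥0∞ := D * (D' * (1 + D') * t) with hK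
      have hlK : l = 2 * c₀ * K := by
        rw [hl, hΛ, hK]
        push_cast
        ring
      have hK0 : K ≠ 0 := by
        have h1 : (D : ℝ≥0∞) ≠ 0 := by exact_mod_cast (zero_lt_one.trans_le hD1).ne'
        have h2 : (D' : ℝ≥0∞) ≠ 0 := by exact_mod_cast (zero_lt_one.trans_le hD'1).ne'
        simp [hK, h1, h2, ht0]
      have hKtop : K ≠ ∞ := by
        rw [hK]
        finiteness
      have hKl : K ≤ l := by
        rw [hlK]
        refine le_mul_of_one_le_left' ?_
        exact_mod_cast one_le_mul (by norm_num) hc₀1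
      obtain ⟨u, hu, hup, husum, huae⟩ := hD (fun y => ‖b y - κ‖ₑ) (aemeasurable_enorm_sub hb κ)
        (lintegral_enorm_sub_ne_top hb κ) c r _ l hr hint hKl
      have : Countable u := hu.to_subtype
      have hsum : 2 * c₀ * ∑' p : u, gauss n (ball p.1.1 p.1.2) ≤ gauss n (ball c r) := by
        rw [← ENNReal.mul_le_mul_iff_right hK0 hKtop]
        refine le_trans (le_of_eq ?_) husum
        rw [hlK]
        ring
      have hball : ∀ p ∈ u, ∫⁻ y in ball p.1 p.2, (min ‖b y - κ‖ₑ N) ^ s ∂(gauss n) ≤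
          c₀ * (J + l ^ s) * gauss n (ball p.1 p.2) := by
        intro p hp
        obtain ⟨hp1, hp2⟩ := hup p hp
        have h1 := enorm_ballAvg_sub_le hb hp1.1 hp2
        calc ∫⁻ y in ball p.1 p.2, (min ‖b y - κ‖ₑ N) ^ s ∂(gauss n)
            ≤ ∫⁻ y in ball p.1 p.2,
              c₀ * ((min ‖b y - ballAvg b p.1 p.2‖ₑ N) ^ s + l ^ s) ∂(gauss n) := by
              refine lintegral_mono fun y => ?_
              have h2 : min ‖b y - κ‖ₑ N ≤ min ‖b y - ballAvg b p.1 p.2‖ₑ N + l := by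
                rw [min_add]
                refine min_le_min ?_ le_self_add
                exact (enorm_sub_le_add _ (ballAvg b p.1 p.2) _).trans (by gcongr)
              refine (ENNReal.rpow_le_rpow h2 hs0.le).trans ?_
              rw [← hc₀']
              exact ENNReal.rpow_add_le_mul_rpow_add_rpow _ _ hs
          _ = c₀ * (∫⁻ y in ball p.1 p.2, (min ‖b y - ballAvg b p.1 p.2‖ₑ N) ^ s ∂(gauss n) +
              l ^ s * gauss n (ball p.1 p.2)) := by
              rw [lintegral_const_mul' _ _ (by simp), lintegral_add_right _ measurable_const,
                setLIntegral_const]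
          _ ≤ c₀ * (J * gauss n (ball p.1 p.2) + l ^ s * gauss n (ball p.1 p.2)) := by
              gcongr
              exact hJle _ _ hp1
          _ = _ := by ring
      have hmain : ∫⁻ y in ball c r, (min ‖b y - κ‖ₑ N) ^ s ∂(gauss n) ≤
          l ^ s * gauss n (ball c r) +
            ∑' p : u, ∫⁻ y in ball p.1.1 p.1.2, (min ‖b y - κ‖ₑ N) ^ s ∂(gauss n) := by
        have hmeas : AEMeasurable (fun y => (min ‖b y - κ‖ₑ N) ^ s) (gauss n) :=
          ((aemeasurable_enorm_sub hb κ).min aemeasurable_const).pow_const s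
        calc ∫⁻ y in ball c r, (min ‖b y - κ‖ₑ N) ^ s ∂(gauss n)
            ≤ ∫⁻ y in ball c r, (l ^ s + ∑' p : u,
              (ball p.1.1 p.1.2).indicator (fun y => (min ‖b y - κ‖ₑ N) ^ s) y) ∂(gauss n) := by
              refine setLIntegral_mono_ae' measurableSet_ball ?_
              filter_upwards [huae] with x hx hxc
              rcases le_or_gt ‖b x - κ‖ₑ l with hle | hlt
              · refine le_add_right ?_
                gcongr
                exact (min_le_left _ _).trans hle
              · obtain ⟨p, hp, hxp⟩ := hx hxc hlt
                refine le_add_left ?_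
                refine le_trans ?_ (ENNReal.le_tsum ⟨p, hp⟩)
                rw [indicator_of_mem hxp]
          _ = l ^ s * gauss n (ball c r) + ∑' p : u, ∫⁻ y in ball c r,
              (ball p.1.1 p.1.2).indicator (fun y => (min ‖b y - κ‖ₑ N) ^ s) y ∂(gauss n) := by
              rw [lintegral_add_left measurable_const, setLIntegral_const, lintegral_tsum]
              exact fun p => (hmeas.indicator measurableSet_ball).restrict
          _ ≤ _ := by
              refine add_le_add le_rfl (ENNReal.tsum_le_tsum fun p => ?_)
              rw [← lintegral_indicator (measurableSet_ball (x := p.1.1) (ε := p.1.2))]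
              exact setLIntegral_le_lintegral _ _
      calc 2 * ∫⁻ y in ball c r, (min ‖b y - κ‖ₑ N) ^ s ∂(gauss n)
          ≤ 2 * (l ^ s * gauss n (ball c r) +
            ∑' p : u, c₀ * (J + l ^ s) * gauss n (ball p.1.1 p.1.2)) := by
            gcongr
            refine hmain.trans ?_
            gcongr with p
            exact hball _ p.2
        _ = 2 * l ^ s * gauss n (ball c r) +
            (J + l ^ s) * (2 * c₀ * ∑' p : u, gauss n (ball p.1.1 p.1.2)) := by
            rw [ENNReal.tsum_mul_left]
            ring
        _ ≤ 2 * l ^ s * gauss n (ball c r) + (J + l ^ s) * gauss n (ball c r) := by gcongr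
        _ = _ := by ring
    have hJ2 : 2 * J ≤ 3 * l ^ s + J := by
      rw [mul_comm, ← ENNReal.le_div_iff_mul_le (by simp) (by simp)]
      refine iSup_le fun c => iSup_le fun r => iSup_le fun hr => ?_
      refine ENNReal.div_le_of_le_mul ?_
      rw [ENNReal.div_eq_inv_mul, mul_assoc]
      calc _ = 2⁻¹ * (2 * ∫⁻ y in ball c r, (min ‖b y - ballAvg b c r‖ₑ N) ^ s ∂(gauss n)) := by
            rw [← mul_assoc, ENNReal.inv_mul_cancel (by simp) (by simp), one_mul]
        _ ≤ _ := by
            exact mul_le_mul' le_rfl (step c r hr)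
    have hJ3 : J ≤ 3 * l ^ s := by
      rw [two_mul] at hJ2
      exact (ENNReal.add_le_add_iff_right hJtop).1 hJ2
    intro c r hr
    exact (hJle c r hr).trans (by gcongr)
  intro c r hr
  have hsup : ∀ y, ‖b y - ballAvg b c r‖ₑ ^ s =
      ⨆ N : ℕ, (min ‖b y - ballAvg b c r‖ₑ N) ^ s := by
    intro y
    refine le_antisymm ?_ (iSup_le fun N => by gcongr; exact min_le_left _ _)
    obtain ⟨N, hN⟩ := ENNReal.exists_nat_gt (enorm_ne_top (x := b y - ballAvg b c r))
    refine le_iSup_of_le N ?_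
    rw [min_eq_left hN.le]
  simp_rw [hsup]
  rw [lintegral_iSup']
  · exact iSup_le fun N => key N c r hr
  · exact fun N => (((aemeasurable_enorm_sub hb _).min aemeasurable_const).pow_const s).restrict
  · refine ae_of_all _ fun y N N' hNN => ?_
    simp only
    gcongr

/-! ### Enlarging the class of balls -/

/-- Both balls of radius `ρ` lie in the ball of radius `2 * ρ` about `x`, whose mean is within `D *
t` of each of theirs. -/
lemma enorm_ballAvg_sub_ballAvg_le {b : E n → ℝ} (hb : Integrable b (gauss n)) {δ : ℝ} {t : ℝ≥0∞}
    (hosc : OscBound b 1 δ t) {D : ℝ≥0}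
    (hD : ∀ (c x : E n) (r ρ : ℝ), Admissible δ c r → r ≤ 5 * ρ →
      ball x ρ ⊆ ball c r → gauss n (ball c r) ≤ D * gauss n (ball x ρ))
    {x y : E n} {ρ : ℝ} (hρ : Admissible δ x (2 * ρ)) (hxy : dist y x ≤ ρ) :
    ‖ballAvg b y ρ - ballAvg b x ρ‖ₑ ≤ 2 * D * t := by
  have hρ0 : 0 < ρ := by linarith [hρ.1]
  have h : ∀ z, dist z x ≤ ρ → ‖ballAvg b z ρ - ballAvg b x (2 * ρ)‖ₑ ≤ D * t := by
    intro z hz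
    have hsub : ball z ρ ⊆ ball x (2 * ρ) := ball_subset_ball' (by linarith)
    have h1 := hosc x (2 * ρ) hρ
    simp only [ENNReal.rpow_one] at h1
    refine enorm_ballAvg_sub_le hb hρ0 ((lintegral_mono_set hsub).trans (h1.trans ?_))
    calc t * gauss n (ball x (2 * ρ)) ≤ t * (D * gauss n (ball z ρ)) := by
          gcongr
          exact hD _ _ _ _ hρ (by linarith) hsub
      _ = _ := by ring
  refine (enorm_sub_le_add _ (ballAvg b x (2 * ρ)) _).trans ?_
  rw [mul_assoc, two_mul (D * t : ℝ≥0∞)]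
  refine add_le_add (h y hxy) ?_
  rw [← enorm_neg, neg_sub]
  exact h x (by simpa using hρ0.le)

/-- Oscillation bounds over the balls of `𝓑_δ` imply oscillation bounds over those of `𝓑_A`. -/
lemma exists_oscBound_enlarge (n : ℕ) {δ A s : ℝ} (hδ : 0 < δ) (hA : 0 < A) (hs : 1 ≤ s) :
    ∃ C : ℝ≥0, ∀ (b : E n → ℝ) (t T : ℝ≥0∞), Integrable b (gauss n) →
      OscBound b 1 δ t → OscBound b s δ T → OscBound b s A (C * (T + t ^ s)) := by
  have hs0 : 0 < s := by linarith
  obtain ⟨D, hD1, hD⟩ := exists_gauss_ball_le n (A := δ) (L := 5) hδ (by norm_num)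
  obtain ⟨D', hD'1, hD'⟩ := exists_gauss_ball_le n (A := 2 * A) (L := 2) (by positivity)
    (by norm_num)
  -- Chosen so that `2 r / N ≤ δ m(x)` for every `x` in the ball, using `r ≤ A m(c) ≤ A (1 + A)
  -- m(x)`.
  obtain ⟨N, hN⟩ := exists_nat_gt (2 * A * (1 + A) / δ)
  have hN0 : (0 : ℝ) < N := lt_of_le_of_lt (by positivity) hN
  rw [div_lt_iff₀ hδ] at hN
  set c₀ : ℝ≥0 := 2 ^ (s - 1) with hc₀
  have hc₀' : (2 : ℝ≥0∞) ^ (s - 1) = c₀ := by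
    rw [hc₀, ENNReal.coe_rpow_of_nonneg _ (by linarith)]
    rfl
  set K : ℝ≥0 := N * (2 * D) with hK
  refine ⟨c₀ * 2 * (c₀ * (1 + K ^ s) * (D * D')), fun b t T hb hosc hoscs c r hr => ?_⟩
  have hr0 := hr.1
  set ρ := r / N with hρ
  have hρ0 : 0 < ρ := by positivity
  have hN1 : (1 : ℝ) ≤ N := by
    have : 0 < N := by exact_mod_cast hN0
    exact_mod_cast this
  have hρr : ρ ≤ r := div_le_self hr0.le hN1
  have hadm : ∀ x ∈ ball c r, Admissible δ x (2 * ρ) := by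
    intro x hx
    refine ⟨by positivity, ?_⟩
    have h1 := m_le_mul_m hA.le ((mem_ball.1 hx).le.trans hr.2)
    have h2 := m_pos x
    rw [hρ, ← mul_div_assoc, div_le_iff₀ hN0]
    calc 2 * r ≤ 2 * (A * ((1 + A) * m x)) := by
          have := hr.2.trans (mul_le_mul_of_nonneg_left h1 hA.le)
          linarith
      _ = 2 * A * (1 + A) * m x := by ring
      _ ≤ N * δ * m x := by gcongr
      _ = δ * m x * N := by ring
  -- The segment from `c` to `x` is walked in `N` steps of length at most `ρ`, each moving the mean
  -- by at most `2 * D * t`.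
  have hchain : ∀ x ∈ ball c r, ‖ballAvg b x ρ - ballAvg b c ρ‖ₑ ≤ K * t := by
    intro x hx
    have hxr : ‖x - c‖ < r := by rwa [← dist_eq_norm]
    have hind : ∀ i : ℕ, i ≤ N →
        ‖ballAvg b (c + ((i : ℝ) / N) • (x - c)) ρ - ballAvg b c ρ‖ₑ ≤ i * (2 * D * t) := by
      intro i
      induction i with
      | zero => simp
      | succ i ih =>
        intro hi
        have hiN : (i : ℝ) / N ≤ 1 := by
          rw [div_le_one hN0]
          exact_mod_cast (by omega : i ≤ N)
        have hmem : c + ((i : ℝ) / N) • (x - c) ∈ ball c r := by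
          rw [mem_ball, dist_eq_norm, add_sub_cancel_left, norm_smul, Real.norm_of_nonneg
            (by positivity)]
          nlinarith [norm_nonneg (x - c)]
        have hdist : dist (c + (((i + 1 : ℕ) : ℝ) / N) • (x - c)) (c + ((i : ℝ) / N) • (x - c)) ≤
            ρ := by
          rw [dist_add_left, dist_eq_norm, ← sub_smul, norm_smul, ← sub_div]
          push_cast
          rw [add_sub_cancel_left, Real.norm_of_nonneg (by positivity), hρ, div_mul_eq_mul_div,
            one_mul]
          gcongr
        refine (enorm_sub_le_add _ (ballAvg b (c + ((i : ℝ) / N) • (x - c)) ρ) _).trans ?_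
        refine (add_le_add (enorm_ballAvg_sub_ballAvg_le hb hosc hD (hadm _ hmem) hdist)
          (ih (by omega))).trans (le_of_eq ?_)
        push_cast
        ring
    have h := hind N le_rfl
    rw [div_self hN0.ne', one_smul, add_sub_cancel] at h
    refine h.trans (le_of_eq ?_)
    rw [hK]
    push_cast
    ring
  have hballs : ∀ x ∈ ball c r, ∫⁻ y in ball x ρ, ‖b y - ballAvg b c ρ‖ₑ ^ s ∂(gauss n) ≤
      c₀ * (T + (K * t) ^ s) * gauss n (ball x ρ) := by
    intro x hx
    have hx' : Admissible δ x ρ := ⟨hρ0, by linarith [(hadm x hx).2]⟩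
    calc ∫⁻ y in ball x ρ, ‖b y - ballAvg b c ρ‖ₑ ^ s ∂(gauss n)
        ≤ ∫⁻ y in ball x ρ, c₀ * (‖b y - ballAvg b x ρ‖ₑ ^ s + (K * t) ^ s) ∂(gauss n) := by
          refine lintegral_mono fun y => ?_
          refine (ENNReal.rpow_le_rpow (enorm_sub_le_add _ (ballAvg b x ρ) _) hs0.le).trans ?_
          refine (ENNReal.rpow_add_le_mul_rpow_add_rpow _ _ hs).trans ?_
          rw [hc₀']
          gcongr
          exact hchain x hx
      _ = c₀ * (∫⁻ y in ball x ρ, ‖b y - ballAvg b x ρ‖ₑ ^ s ∂(gauss n) +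
          (K * t) ^ s * gauss n (ball x ρ)) := by
          rw [lintegral_const_mul' _ _ (by simp), lintegral_add_right _ measurable_const,
            setLIntegral_const]
      _ ≤ c₀ * (T * gauss n (ball x ρ) + (K * t) ^ s * gauss n (ball x ρ)) := by
          gcongr
          exact hoscs x ρ hx'
      _ = _ := by ring
  -- Selecting disjoint balls of radius `ρ / 5` makes the balls of radius `ρ` a cover, with total
  -- mass controlled by doubling.
  obtain ⟨u, huF, hu, hd, hc⟩ := exists_vitali_subfamily
    (F := {p : E n × ℝ | p.1 ∈ ball c r ∧ p.2 = ρ / 5}) (R := ρ / 5)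
    (fun p hp => ⟨by rw [hp.2]; positivity, hp.2.le⟩)
  have : Countable u := hu.to_subtype
  have hcover : ball c r ⊆ ⋃ p ∈ u, ball p.1 ρ := by
    intro x hx
    obtain ⟨q, hq, hsub⟩ := hc (x, ρ / 5) ⟨hx, rfl⟩
    have h1 : x ∈ ball q.1 (5 * q.2) := hsub (mem_ball_self (by positivity))
    have h2 : 5 * q.2 = ρ := by rw [(huF hq).2]; ring
    rw [h2] at h1
    exact mem_biUnion hq h1
  have hsum : ∑' p : u, gauss n (ball p.1.1 ρ) ≤ D * D' * gauss n (ball c r) := by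
    calc ∑' p : u, gauss n (ball p.1.1 ρ) ≤ ∑' p : u, D * gauss n (ball p.1.1 p.1.2) := by
          gcongr with p
          have hp := huF p.2
          have hp' := hadm _ hp.1
          refine hD _ _ _ _ ⟨hρ0, by linarith [hp'.2]⟩ (by rw [hp.2]; linarith)
            (ball_subset_ball (by rw [hp.2]; linarith))
      _ = D * ∑' p : u, ∫⁻ _ in ball p.1.1 p.1.2, 1 ∂(gauss n) := by
          simp only [setLIntegral_one, ENNReal.tsum_mul_left]
      _ ≤ D * ∫⁻ _ in ball c (2 * r), 1 ∂(gauss n) := by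
          gcongr
          refine tsum_setLIntegral_le hu hd (fun p hp => ?_) _
          have hp := huF hp
          refine ball_subset_ball' ?_
          rw [hp.2]
          linarith [mem_ball.1 hp.1]
      _ ≤ D * (D' * gauss n (ball c r)) := by
          rw [setLIntegral_one]
          gcongr
          exact hD' _ _ _ _ (hr.mul (by norm_num)) le_rfl (ball_subset_ball (by linarith))
      _ = _ := by ring
  have hκ : ∫⁻ y in ball c r, ‖b y - ballAvg b c ρ‖ₑ ^ s ∂(gauss n) ≤
      (c₀ * (T + (K * t) ^ s) * (D * D')) * gauss n (ball c r) := by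
    calc ∫⁻ y in ball c r, ‖b y - ballAvg b c ρ‖ₑ ^ s ∂(gauss n)
        ≤ ∫⁻ y in ⋃ p : u, ball p.1.1 ρ, ‖b y - ballAvg b c ρ‖ₑ ^ s ∂(gauss n) := by
          refine lintegral_mono_set ?_
          rwa [biUnion_eq_iUnion] at hcover
      _ ≤ ∑' p : u, ∫⁻ y in ball p.1.1 ρ, ‖b y - ballAvg b c ρ‖ₑ ^ s ∂(gauss n) :=
          lintegral_iUnion_le _ _
      _ ≤ ∑' p : u, c₀ * (T + (K * t) ^ s) * gauss n (ball p.1.1 ρ) := by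
          gcongr with p
          exact hballs _ (huF p.2).1
      _ = c₀ * (T + (K * t) ^ s) * ∑' p : u, gauss n (ball p.1.1 ρ) := ENNReal.tsum_mul_left
      _ ≤ c₀ * (T + (K * t) ^ s) * (D * D' * gauss n (ball c r)) := by gcongr
      _ = _ := by ring
  refine (lintegral_enorm_sub_ballAvg_rpow_le hb hs hr0 hκ).trans (mul_le_mul' ?_ le_rfl)
  rw [hc₀']
  have hT : T + (K * t) ^ s ≤ (1 + K ^ s : ℝ≥0) * (T + t ^ s) := by
    rw [ENNReal.mul_rpow_of_nonneg _ _ hs0.le, ← ENNReal.coe_rpow_of_nonneg _ hs0.le]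
    push_cast
    calc T + ((K ^ s : ℝ≥0) : ℝ≥0∞) * t ^ s
        ≤ (T + ((K ^ s : ℝ≥0) : ℝ≥0∞) * t ^ s) + (t ^ s + ((K ^ s : ℝ≥0) : ℝ≥0∞) * T) :=
          le_self_add
      _ = _ := by ring
  calc (c₀ : ℝ≥0∞) * (2 * (c₀ * (T + (K * t) ^ s) * (D * D')))
      ≤ c₀ * (2 * (c₀ * ((1 + K ^ s : ℝ≥0) * (T + t ^ s)) * (D * D'))) := by gcongr
    _ = _ := by
        push_cast
        ring

/-- Mean oscillations over the balls of `𝓑_1` control power mean oscillations over those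
of `𝓑_A`. -/
lemma exists_oscBound_rpow_enlarge (n : ℕ) {A s : ℝ} (hA : 0 < A) (hs : 1 ≤ s) :
    ∃ C : ℝ≥0, 0 < C ∧ ∀ (b : E n → ℝ) (t : ℝ≥0∞), Integrable b (gauss n) → t ≠ 0 → t ≠ ∞ →
      OscBound b 1 1 t → OscBound b s A (C * t ^ s) := by
  obtain ⟨C, hC⟩ := exists_oscBound_rpow n hs
  obtain ⟨C', hC'⟩ := exists_oscBound_enlarge n (δ := 1 / 2) (by norm_num) hA hs
  refine ⟨C' * (C + 1) + 1, by positivity, fun b t hb ht0 ht hosc => ?_⟩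
  refine (hC' b t _ hb (hosc.mono (by norm_num) le_rfl) (hC b t hb ht0 ht hosc)).mono le_rfl ?_
  calc (C' : ℝ≥0∞) * (C * t ^ s + t ^ s) ≤ C' * (C * t ^ s + t ^ s) + t ^ s := le_self_add
    _ = _ := by
      push_cast
      ring

/-! ### The maximal commutator -/

/-- The maximal commutator `sup_{B ∋ x} γ(B)^{β-1} ∫_B |b(x) - b(y)| g(y) dγ(y)`. -/
noncomputable def maxCommutator (a β : ℝ) (b : E n → ℝ) (g : E n → ℝ≥0∞) (x : E n) : ℝ≥0∞ :=
  ⨆ (c : E n) (r : ℝ) (_ : Admissible a c r) (_ : x ∈ ball c r),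
    (∫⁻ y in ball c r, ‖b x - b y‖ₑ * g y ∂(gauss n)) / (gauss n (ball c r)) ^ (1 - β)

/-- The maximal function `sup_{B ∋ x} |b(x) - b_B| γ(B)^{β-1} ∫_B g dγ`. -/
noncomputable def oscMax (a β : ℝ) (b : E n → ℝ) (g : E n → ℝ≥0∞) (x : E n) : ℝ≥0∞ :=
  ⨆ (c : E n) (r : ℝ) (_ : Admissible a c r) (_ : x ∈ ball c r),
    ‖b x - ballAvg b c r‖ₑ *
      ((∫⁻ y in ball c r, g y ∂(gauss n)) / (gauss n (ball c r)) ^ (1 - β))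

/-- If the fractional average of `g` over `B` lies in `(2 ^ k, 2 ^ (k + 1)]`, then `B` lies in the
fivefold enlargement of a ball `p` selected at level `k`. With `κ p` the mean over that enlargement
and `G p` the function `|b - κ p|` cut off to it, `|b x - b_B|` is at most `G p x` plus the local
maximal function of `G p` at `x`. The maximal theorem in `L^q` bounds the contribution of `p` by `T
γ(p)` up to constants. The selected balls are disjoint and contained in `{𝓜 g > 2 ^ k}`, so summing
over `k` restores the integral of `(𝓜 g) ^ q`. -/
lemma exists_lintegral_oscMax_rpow_le (n : ℕ) {a q : ℝ} (β : ℝ) (ha : 0 < a) (hq : 1 < q) :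
    ∃ C : ℝ≥0, ∀ (b : E n → ℝ) (T : ℝ≥0∞) (g : E n → ℝ≥0∞), Integrable b (gauss n) →
      OscBound b q (5 * a) T → ∫⁻ y, g y ∂(gauss n) ≠ ∞ →
      ∫⁻ x, oscMax a β b g x ^ q ∂(gauss n) ≤ C * T * ∫⁻ x, gMax a β g x ^ q ∂(gauss n) := by
  have hq0 : 0 < q := by linarith
  obtain ⟨D, hD1, hD⟩ := exists_gauss_ball_le n (A := 5 * a) (L := 5) (by positivity) (by norm_num)
  obtain ⟨C₁, -, hC₁⟩ := exists_lintegral_gMax_zero_rpow_le n ha hq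
  obtain ⟨C₂, -, hC₂⟩ := exists_tsum_zpow_rpow_le hq0
  refine ⟨2 ^ q * (2 ^ (q - 1) * (1 + C₁) * D) * C₂, fun b T g hb hosc hg => ?_⟩
  set F : ℤ → Set (E n × ℝ) := fun k => {p | Admissible a p.1 p.2 ∧ (2 : ℝ≥0∞) ^ k <
    (∫⁻ y in ball p.1 p.2, g y ∂(gauss n)) / (gauss n (ball p.1 p.2)) ^ (1 - β)} with hF
  have hvit := fun k : ℤ => exists_vitali_subfamily (F := F k) (R := a)
    (fun p hp => ⟨hp.1.1, hp.1.le ha.le⟩)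
  choose u huF hu hd hc using hvit
  have hcount : ∀ k, Countable (u k) := fun k => (hu k).to_subtype
  set κ : E n × ℝ → ℝ := fun p => ballAvg b p.1 (5 * p.2) with hκ
  set G : E n × ℝ → E n → ℝ≥0∞ :=
    fun p => (ball p.1 (5 * p.2)).indicator (fun y => ‖b y - κ p‖ₑ) with hG
  have hGm : ∀ p, AEMeasurable (G p) (gauss n) := fun p =>
    (aemeasurable_enorm_sub hb _).indicator measurableSet_ball
  set S : E n × ℝ → E n → ℝ≥0∞ := fun p x => (G p x + gMax a 0 (G p) x) ^ q with hS
  have hSm : ∀ p, AEMeasurable (S p) (gauss n) := fun p =>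
    ((hGm p).add (measurable_gMax _ _ _).aemeasurable).pow_const q
  have hpt : ∀ x, oscMax a β b g x ^ q ≤ ∑' k : ℤ, ∑' p : u k, ((2 : ℝ≥0∞) ^ (k + 1)) ^ q * S p x := by
    intro x
    rw [← ENNReal.le_rpow_inv_iff hq0]
    refine iSup_le fun c => iSup_le fun r => iSup_le fun hr => iSup_le fun hx => ?_
    rw [ENNReal.le_rpow_inv_iff hq0]
    set Y := (∫⁻ y in ball c r, g y ∂(gauss n)) / (gauss n (ball c r)) ^ (1 - β) with hY
    rcases eq_or_ne Y 0 with h0 | h0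
    · simp [h0, hq0]
    -- Integrability of `g` is what guarantees that a dyadic level `k` exists.
    have hYtop : Y ≠ ∞ := by
      refine ENNReal.div_ne_top (ne_top_of_le_ne_top hg (setLIntegral_le_lintegral _ _)) ?_
      simp [ENNReal.rpow_eq_zero_iff, gauss_ball_ne_zero c hr.1]
    obtain ⟨k, hk1, hk2⟩ := ENNReal.exists_mem_Ioc_zpow h0 hYtop (y := 2) (by norm_num)
      (by norm_num)
    obtain ⟨p, hp, hsub⟩ := hc k (c, r) ⟨hr, hk1⟩
    simp only at hsub
    have hx1 : ‖b x - κ p‖ₑ = G p x := (indicator_of_mem (hsub hx) (fun y => ‖b y - κ p‖ₑ)).symm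
    have hx2 : ‖ballAvg b c r - κ p‖ₑ ≤ gMax a 0 (G p) x := by
      refine enorm_ballAvg_sub_le hb hr.1 ?_
      rw [← ENNReal.div_le_iff (gauss_ball_ne_zero c hr.1) (measure_ne_top _ _)]
      have := le_gMax (β := 0) (G p) hr hx
      rw [sub_zero, ENNReal.rpow_one] at this
      refine le_trans (le_of_eq ?_) this
      congr 1
      exact setLIntegral_congr_fun measurableSet_ball fun y hy =>
        (indicator_of_mem (hsub hy) (fun y => ‖b y - κ p‖ₑ)).symm
    have hx3 : ‖b x - ballAvg b c r‖ₑ ≤ G p x + gMax a 0 (G p) x := by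
      refine (enorm_sub_le_add _ (κ p) _).trans (add_le_add hx1.le ?_)
      rwa [← enorm_neg, neg_sub]
    calc (‖b x - ballAvg b c r‖ₑ * Y) ^ q
        ≤ ((G p x + gMax a 0 (G p) x) * (2 : ℝ≥0∞) ^ (k + 1)) ^ q := by gcongr
      _ = ((2 : ℝ≥0∞) ^ (k + 1)) ^ q * S p x := by
          rw [ENNReal.mul_rpow_of_nonneg _ _ hq0.le, mul_comm]
      _ ≤ ∑' p : u k, ((2 : ℝ≥0∞) ^ (k + 1)) ^ q * S p x :=
          ENNReal.le_tsum (f := fun p : u k => ((2 : ℝ≥0∞) ^ (k + 1)) ^ q * S p x) ⟨p, hp⟩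
      _ ≤ _ := ENNReal.le_tsum
          (f := fun k => ∑' p : u k, ((2 : ℝ≥0∞) ^ (k + 1)) ^ q * S p x) k
  have hSint : ∀ k, ∀ p ∈ u k, ∫⁻ x, S p x ∂(gauss n) ≤
      (2 ^ (q - 1) * (1 + C₁) * D) * T * gauss n (ball p.1 p.2) := by
    intro k p hp
    have hpa := (huF k hp).1
    have hpa5 : Admissible (5 * a) p.1 (5 * p.2) := hpa.mul (by norm_num)
    have hGint : ∫⁻ x, G p x ^ q ∂(gauss n) ≤ T * (D * gauss n (ball p.1 p.2)) := by
      calc ∫⁻ x, G p x ^ q ∂(gauss n)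
          = ∫⁻ x in ball p.1 (5 * p.2), ‖b x - κ p‖ₑ ^ q ∂(gauss n) := by
            rw [← lintegral_indicator measurableSet_ball]
            congr 1
            ext x
            by_cases hx : x ∈ ball p.1 (5 * p.2)
            · simp only [hG, indicator_of_mem hx]
            · simp only [hG, indicator_of_notMem hx, ENNReal.zero_rpow_of_pos hq0]
        _ ≤ T * gauss n (ball p.1 (5 * p.2)) := hosc _ _ hpa5
        _ ≤ _ := by
            gcongr
            exact hD _ _ _ _ hpa5 le_rfl (ball_subset_ball (by linarith [hpa.1]))
    calc ∫⁻ x, S p x ∂(gauss n)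
        ≤ ∫⁻ x, 2 ^ (q - 1) * (G p x ^ q + gMax a 0 (G p) x ^ q) ∂(gauss n) :=
          lintegral_mono fun x => ENNReal.rpow_add_le_mul_rpow_add_rpow _ _ hq.le
      _ = 2 ^ (q - 1) * (∫⁻ x, G p x ^ q ∂(gauss n) + ∫⁻ x, gMax a 0 (G p) x ^ q ∂(gauss n)) := by
          rw [lintegral_const_mul' _ _ (ENNReal.rpow_ne_top_of_nonneg (by linarith) (by simp)),
            lintegral_add_right _ ((measurable_gMax _ _ _).pow_const q)]
      _ ≤ 2 ^ (q - 1) * (∫⁻ x, G p x ^ q ∂(gauss n) + C₁ * ∫⁻ x, G p x ^ q ∂(gauss n)) := by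
          gcongr
          exact hC₁ _ (hGm p)
      _ = 2 ^ (q - 1) * (1 + C₁) * ∫⁻ x, G p x ^ q ∂(gauss n) := by ring
      _ ≤ 2 ^ (q - 1) * (1 + C₁) * (T * (D * gauss n (ball p.1 p.2))) := by gcongr
      _ = _ := by ring
  have husum : ∀ k, ∑' p : u k, gauss n (ball p.1.1 p.1.2) ≤
      gauss n {x | (2 : ℝ≥0∞) ^ k < gMax a β g x} := by
    intro k
    have := tsum_setLIntegral_le (hu k) (hd k) (s := {x | (2 : ℝ≥0∞) ^ k < gMax a β g x})
      (fun p hp x hx => lt_gMax_iff.2 ⟨p.1, p.2, (huF k hp).1, hx, (huF k hp).2⟩) (fun _ => 1)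
    simpa only [setLIntegral_one] using this
  have hms : ∀ k : ℤ, MeasurableSet {x : E n | (2 : ℝ≥0∞) ^ k < gMax a β g x} := fun k =>
    measurableSet_lt measurable_const (measurable_gMax a β g)
  calc ∫⁻ x, oscMax a β b g x ^ q ∂(gauss n)
      ≤ ∫⁻ x, ∑' k : ℤ, ∑' p : u k, ((2 : ℝ≥0∞) ^ (k + 1)) ^ q * S p x ∂(gauss n) :=
        lintegral_mono hpt
    _ = ∑' k : ℤ, ∑' p : u k, ((2 : ℝ≥0∞) ^ (k + 1)) ^ q * ∫⁻ x, S p x ∂(gauss n) := by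
        rw [lintegral_tsum fun k => AEMeasurable.tsum fun p : u k => (hSm p).const_mul _]
        refine tsum_congr fun k => ?_
        rw [lintegral_tsum fun p : u k => (hSm p).const_mul _]
        refine tsum_congr fun p => ?_
        rw [lintegral_const_mul' _ _ (ENNReal.rpow_ne_top_of_nonneg hq0.le
          (ENNReal.zpow_ne_top (by simp) (by simp) _))]
    _ ≤ ∑' k : ℤ, ∑' p : u k, ((2 : ℝ≥0∞) ^ (k + 1)) ^ q *
        ((2 ^ (q - 1) * (1 + C₁) * D) * T * gauss n (ball p.1.1 p.1.2)) := by
        gcongr with k p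
        exact hSint k _ p.2
    _ = ∑' k : ℤ, (2 ^ q * (2 ^ (q - 1) * (1 + C₁) * D) * T) * (((2 : ℝ≥0∞) ^ k) ^ q *
        ∑' p : u k, gauss n (ball p.1.1 p.1.2)) := by
        refine tsum_congr fun k => ?_
        rw [ENNReal.tsum_mul_left, ENNReal.tsum_mul_left,
          ENNReal.zpow_add (by norm_num) (by norm_num), zpow_one,
          ENNReal.mul_rpow_of_nonneg _ _ hq0.le]
        ring
    _ ≤ ∑' k : ℤ, (2 ^ q * (2 ^ (q - 1) * (1 + C₁) * D) * T) * (((2 : ℝ≥0∞) ^ k) ^ q *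
        gauss n {x | (2 : ℝ≥0∞) ^ k < gMax a β g x}) := by
        gcongr with k
        exact husum k
    _ = (2 ^ q * (2 ^ (q - 1) * (1 + C₁) * D) * T) * ∫⁻ x, ∑' k : ℤ,
        (if (2 : ℝ≥0∞) ^ k < gMax a β g x then ((2 : ℝ≥0∞) ^ k) ^ q else 0) ∂(gauss n) := by
        rw [ENNReal.tsum_mul_left, lintegral_tsum]
        · congr 2
          ext k
          rw [← lintegral_indicator_const (hms k)]
          simp only [indicator, mem_ofPred_eq]
        · exact fun k => (Measurable.ite (hms k) measurable_const measurable_const).aemeasurable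
    _ ≤ (2 ^ q * (2 ^ (q - 1) * (1 + C₁) * D) * T) * ∫⁻ x, C₂ * gMax a β g x ^ q ∂(gauss n) := by
        refine mul_le_mul' le_rfl (lintegral_mono fun x => hC₂ _)
    _ = _ := by
        rw [lintegral_const_mul' _ _ (by simp)]
        push_cast
        rw [ENNReal.coe_rpow_of_nonneg _ hq0.le, ENNReal.coe_rpow_of_nonneg _ (by linarith)]
        push_cast
        ring

/-- Hölder with exponents `s'` and `s`. The order `β * s` on `g ^ s` is forced by `1 / s' + (1 - β
s) / s = 1 - β`. -/
lemma lintegral_osc_mul_div_le {a β s : ℝ} (hs : 1 < s) {b : E n → ℝ} {T : ℝ≥0∞}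
    {g : E n → ℝ≥0∞} (hb : Integrable b (gauss n)) (hg : AEMeasurable g (gauss n))
    (hosc : OscBound b s.conjExponent a T) {c x : E n} {r : ℝ} (hr : Admissible a c r)
    (hx : x ∈ ball c r) :
    (∫⁻ y in ball c r, ‖b y - ballAvg b c r‖ₑ * g y ∂(gauss n)) / (gauss n (ball c r)) ^ (1 - β) ≤
      T ^ (1 / s.conjExponent) * gMax a (β * s) (fun y => g y ^ s) x ^ (1 / s) := by
  have hss := Real.HolderConjugate.conjExponent hs
  set s' := s.conjExponent with hs'
  have hs0 : 0 < s := by linarith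
  have hs'0 : 0 < s' := hss.symm.pos
  set v := gauss n (ball c r) with hv
  have hv0 : v ≠ 0 := gauss_ball_ne_zero c hr.1
  have hvt : v ≠ ∞ := measure_ne_top _ _
  set M := gMax a (β * s) (fun y => g y ^ s) x with hM
  have h1 : ∫⁻ y in ball c r, g y ^ s ∂(gauss n) ≤ M * v ^ (1 - β * s) := by
    have := le_gMax (β := β * s) (fun y => g y ^ s) hr hx
    refine (ENNReal.div_le_iff ?_ ?_).1 this
    · simp [ENNReal.rpow_eq_zero_iff, hv0, hvt]
    · simp [ENNReal.rpow_eq_top_iff, hv0, hvt]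
  have h2 := ENNReal.lintegral_mul_le_Lp_mul_Lq ((gauss n).restrict (ball c r)) hss.symm
    (aemeasurable_enorm_sub hb (ballAvg b c r)).restrict hg.restrict
  refine ENNReal.div_le_of_le_mul ?_
  calc _ ≤ _ := h2
    _ ≤ (T * v) ^ (1 / s') * (M * v ^ (1 - β * s)) ^ (1 / s) := by
        gcongr
        exact hosc c r hr
    _ = T ^ (1 / s') * M ^ (1 / s) * (v ^ (1 / s') * v ^ ((1 - β * s) * (1 / s))) := by
        rw [ENNReal.mul_rpow_of_nonneg _ _ (by positivity),
          ENNReal.mul_rpow_of_nonneg _ _ (by positivity), ← ENNReal.rpow_mul]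
        ring
    _ = _ := by
        rw [← ENNReal.rpow_add _ _ hv0 hvt]
        congr 2
        have := hss.inv_add_inv_eq_one
        rw [one_div, one_div, sub_mul, mul_assoc, mul_inv_cancel₀ hs0.ne']
        linarith

lemma maxCommutator_le {a β s : ℝ} (hs : 1 < s) {b : E n → ℝ} {T : ℝ≥0∞}
    {g : E n → ℝ≥0∞} (hb : Integrable b (gauss n)) (hg : AEMeasurable g (gauss n))
    (hosc : OscBound b s.conjExponent a T) (x : E n) :
    maxCommutator a β b g x ≤ oscMax a β b g x +
      T ^ (1 / s.conjExponent) * gMax a (β * s) (fun y => g y ^ s) x ^ (1 / s) := by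
  refine iSup_le fun c => iSup_le fun r => iSup_le fun hr => iSup_le fun hx => ?_
  refine le_trans ?_ (add_le_add (le_iSup_of_le c <| le_iSup_of_le r <| le_iSup_of_le hr <|
    le_iSup_of_le hx le_rfl) (lintegral_osc_mul_div_le hs hb hg hosc hr hx))
  rw [← mul_div_assoc, ← ENNReal.add_div]
  gcongr
  rw [← lintegral_const_mul' _ _ enorm_ne_top, ← lintegral_add_left' (hg.restrict.const_mul _)]
  refine lintegral_mono fun y => ?_
  simp only
  rw [← add_mul]
  gcongr
  refine (enorm_sub_le_add _ (ballAvg b c r) _).trans (add_le_add le_rfl ?_)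
  rw [← enorm_neg, neg_sub]

/-- The maximal commutator with a function of bounded mean oscillation is bounded from `L^p`
to `L^q`. -/
lemma exists_lintegral_maxCommutator_rpow_le (n : ℕ) {a β p q : ℝ} (ha : 0 < a) (hβ0 : 0 < β)
    (hp : 1 < p) (hpq : p < q) (hβ : 1 / q = 1 / p - β) :
    ∃ C : ℝ≥0, 0 < C ∧ ∀ (b : E n → ℝ) (t : ℝ≥0∞) (g : E n → ℝ≥0∞), Integrable b (gauss n) →
      t ≠ 0 → t ≠ ∞ → OscBound b 1 1 t → AEMeasurable g (gauss n) → ∫⁻ y, g y ∂(gauss n) ≠ ∞ →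
      ∫⁻ x, maxCommutator a β b g x ^ q ∂(gauss n) ≤
        C * t ^ q * (∫⁻ x, g x ^ p ∂(gauss n)) ^ (q / p) := by
  have hq1 : 1 < q := hp.trans hpq
  have hq0 : 0 < q := by linarith
  have hp0 : 0 < p := by linarith
  -- Any `s` strictly between `1` and `p` works: `s > 1` permits Hölder, and `p / s > 1` permits the
  -- fractional maximal theorem for `(p / s, q / s, β * s)`, which satisfy the same relation as `(p,
  -- q, β)`.
  set s : ℝ := (1 + p) / 2 with hs_def
  have hs : 1 < s := by rw [hs_def]; linarith
  have hsp : s < p := by rw [hs_def]; linarith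
  have hs0 : 0 < s := by linarith
  have hss := Real.HolderConjugate.conjExponent hs
  have hs'1 : 1 ≤ s.conjExponent := hss.symm.lt.le
  have hs'0 : 0 < s.conjExponent := by linarith
  obtain ⟨C₁, -, hC₁⟩ := exists_oscBound_rpow_enlarge n (A := 5 * a) (by positivity) hq1.le
  obtain ⟨C₂, -, hC₂⟩ := exists_oscBound_rpow_enlarge n ha hs'1
  obtain ⟨C₃, hC₃⟩ := exists_lintegral_oscMax_rpow_le n β ha hq1
  obtain ⟨C₄, -, hC₄⟩ := exists_lintegral_gMax_rpow_le n ha hβ0.le hp hq0 hβ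
  obtain ⟨C₅, -, hC₅⟩ := exists_lintegral_gMax_rpow_le n (a := a) (β := β * s) (p := p / s)
    (q := q / s) ha (by positivity) (by rwa [one_lt_div hs0]) (by positivity) (by
      rw [one_div_div, one_div_div, div_eq_mul_one_div s q, hβ]
      ring)
  set C₆ : ℝ≥0 := C₂ ^ (q / s.conjExponent) with hC₆
  refine ⟨2 ^ (q - 1) * (C₃ * C₁ * C₄ + C₆ * C₅) + 1, by positivity,
    fun b t g hb ht0 ht hosc hg hgint => ?_⟩
  set I := ∫⁻ x, g x ^ p ∂(gauss n) with hI
  have h1 : ∫⁻ x, oscMax a β b g x ^ q ∂(gauss n) ≤ C₃ * C₁ * C₄ * t ^ q * I ^ (q / p) := by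
    refine (hC₃ b _ g hb (hC₁ b t hb ht0 ht hosc) hgint).trans ?_
    calc _ ≤ C₃ * (C₁ * t ^ q) * (C₄ * I ^ (q / p)) := by
          gcongr
          exact hC₄ g hg
      _ = _ := by ring
  have h2 : ∫⁻ x, gMax a (β * s) (fun y => g y ^ s) x ^ (q / s) ∂(gauss n) ≤ C₅ * I ^ (q / p) := by
    refine (hC₅ _ (hg.pow_const s)).trans (le_of_eq ?_)
    rw [hI, div_div_div_cancel_right₀ hs0.ne']
    congr 3
    ext x
    rw [← ENNReal.rpow_mul, mul_div_cancel₀ _ hs0.ne']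
  set T := (C₂ * t ^ s.conjExponent) ^ (1 / s.conjExponent) with hT
  have hTq : T ^ q = C₆ * t ^ q := by
    rw [hT, ← ENNReal.rpow_mul, ENNReal.mul_rpow_of_nonneg _ _ (by positivity), ← ENNReal.rpow_mul,
      hC₆, ENNReal.coe_rpow_of_nonneg _ (by positivity)]
    congr 2 <;> field_simp
  clear_value C₆
  have hTtop : T ^ q ≠ ∞ := by
    rw [hTq]
    exact ENNReal.mul_ne_top (by simp) (ENNReal.rpow_ne_top_of_nonneg hq0.le ht)
  calc ∫⁻ x, maxCommutator a β b g x ^ q ∂(gauss n)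
      ≤ ∫⁻ x, 2 ^ (q - 1) * (oscMax a β b g x ^ q +
          T ^ q * gMax a (β * s) (fun y => g y ^ s) x ^ (q / s)) ∂(gauss n) := by
        refine lintegral_mono fun x => ?_
        refine (ENNReal.rpow_le_rpow (maxCommutator_le hs hb hg (hC₂ b t hb ht0 ht hosc) x)
          hq0.le).trans ((ENNReal.rpow_add_le_mul_rpow_add_rpow _ _ hq1.le).trans (le_of_eq ?_))
        rw [ENNReal.mul_rpow_of_nonneg _ _ hq0.le, ← ENNReal.rpow_mul (gMax _ _ _ _),
          one_div_mul_eq_div]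
    _ = 2 ^ (q - 1) * (∫⁻ x, oscMax a β b g x ^ q ∂(gauss n) +
          T ^ q * ∫⁻ x, gMax a (β * s) (fun y => g y ^ s) x ^ (q / s) ∂(gauss n)) := by
        rw [lintegral_const_mul' _ _ (ENNReal.rpow_ne_top_of_nonneg (by linarith) (by simp)),
          lintegral_add_right _ (((measurable_gMax _ _ _).pow_const _).const_mul _),
          lintegral_const_mul' _ _ hTtop]
    _ ≤ 2 ^ (q - 1) * (C₃ * C₁ * C₄ * t ^ q * I ^ (q / p) +
          C₆ * t ^ q * (C₅ * I ^ (q / p))) := by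
        rw [hTq]
        gcongr
    _ ≤ 2 ^ (q - 1) * (C₃ * C₁ * C₄ * t ^ q * I ^ (q / p) +
          C₆ * t ^ q * (C₅ * I ^ (q / p))) + t ^ q * I ^ (q / p) := le_self_add
    _ = _ := by
        push_cast
        rw [ENNReal.coe_rpow_of_nonneg _ (by linarith)]
        push_cast
        ring

/-! ### The commutator -/

/-- The hypotheses say that `|u| v` and `X` differ by at most `N`. Replacing `|u|` by `u` changes
nothing for `u ≥ 0` and costs `2 |u| v` for `u < 0`. -/
lemma ereal_abs_mul_sub_le {u : ℝ} {v X N : ℝ≥0∞} (hv : v ≠ ∞) (h1 : ‖u‖ₑ * v ≤ X + N)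
    (h2 : X ≤ ‖u‖ₑ * v + N) :
    ((u : EReal) * (v : EReal) - (X : EReal)).abs ≤ N + 2 * ‖-min 0 u‖ₑ * v := by
  rcases eq_or_ne N ∞ with rfl | hN
  · simp
  have hX : X ≠ ∞ := ne_top_of_le_ne_top (by finiteness) h2
  lift v to ℝ≥0 using hv
  lift N to ℝ≥0 using hN
  lift X to ℝ≥0 using hX
  have h3 : ((u : EReal) * ((v : ℝ≥0∞) : EReal) - ((X : ℝ≥0∞) : EReal)) =
      ((u * v - X : ℝ) : EReal) := by
    push_cast
    rfl
  rw [h3, EReal.abs_def]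
  have e1 : ‖u‖ₑ = (‖u‖₊ : ℝ≥0∞) := rfl
  have e2 : ‖-min 0 u‖ₑ = (‖-min 0 u‖₊ : ℝ≥0∞) := rfl
  rw [e1] at h1 h2
  rw [e2]
  have h1' : |u| * v ≤ X + N := by exact_mod_cast h1
  have h2' : (X : ℝ) ≤ |u| * v + N := by exact_mod_cast h2
  have h4 : |u * v - X| ≤ N + 2 * |-min 0 u| * v := by
    have hv0 : (0 : ℝ) ≤ v := v.2
    rw [abs_neg]
    rcases le_total 0 u with hu | hu
    · rw [abs_of_nonneg hu] at h1' h2'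
      rw [min_eq_left hu, abs_zero, abs_le]
      constructor <;> linarith
    · rw [abs_of_nonpos hu] at h1' h2'
      rw [min_eq_right hu, abs_of_nonpos hu, abs_le]
      constructor <;> nlinarith [mul_nonneg (neg_nonneg.2 hu) hv0]
  refine (ENNReal.ofReal_le_ofReal h4).trans (le_of_eq ?_)
  rw [ENNReal.ofReal_add (by positivity) (by positivity), ENNReal.ofReal_mul (by positivity),
    ENNReal.ofReal_mul (by positivity), ENNReal.ofReal_coe_nnreal, ENNReal.ofReal_coe_nnreal,
    ← Real.enorm_eq_ofReal_abs]
  simp [enorm_eq_nnnorm]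

/-- From `γ(B) = γ(B) ^ β γ(B) ^ (1 - β)` and the finite total mass. It makes the first term of the
commutator a real number everywhere. -/
lemma gMax_ne_top {a β : ℝ} (hβ0 : 0 ≤ β) {g : E n → ℝ≥0∞} {K : ℝ≥0∞} (hK : K ≠ ∞)
    (hg : ∀ᵐ y ∂(gauss n), g y ≤ K) (x : E n) : gMax a β g x ≠ ∞ := by
  refine ne_top_of_le_ne_top (b := K * gauss n univ ^ β) ?_ ?_
  · exact ENNReal.mul_ne_top hK (ENNReal.rpow_ne_top_of_nonneg hβ0 (measure_ne_top _ _))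
  · rw [gMax_le_iff]
    intro c r hr hx
    have hv0 : gauss n (ball c r) ≠ 0 := gauss_ball_ne_zero c hr.1
    have hvt : gauss n (ball c r) ≠ ∞ := measure_ne_top _ _
    refine ENNReal.div_le_of_le_mul ?_
    calc ∫⁻ y in ball c r, g y ∂(gauss n) ≤ ∫⁻ _ in ball c r, K ∂(gauss n) :=
          lintegral_mono_ae (ae_restrict_of_ae hg)
      _ = K * (gauss n (ball c r) ^ β * gauss n (ball c r) ^ (1 - β)) := by
          rw [setLIntegral_const, ← ENNReal.rpow_add _ _ hv0 hvt]
          simp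
      _ ≤ K * (gauss n univ ^ β * gauss n (ball c r) ^ (1 - β)) := by
          gcongr
          exact subset_univ _
      _ = _ := by ring

lemma MemLcInfty.ae_le {f : E n → ℝ} (hf : MemLcInfty f) :
    ∃ K : ℝ≥0∞, K ≠ ∞ ∧ ∀ᵐ y ∂(gauss n), ‖f y‖ₑ ≤ K :=
  ⟨eLpNorm f ∞ (gauss n), hf.1.2.ne, by
    rw [eLpNorm_exponent_top]
    exact enorm_ae_le_eLpNormEssSup f (gauss n)⟩

lemma MemLcInfty.fracMaximal_ne_top {f : E n → ℝ} (hf : MemLcInfty f) {a β : ℝ} (hβ0 : 0 ≤ β)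
    (x : E n) : fracMaximal a β f x ≠ ∞ := by
  obtain ⟨K, hK, hfK⟩ := hf.ae_le
  exact gMax_ne_top hβ0 hK hfK x

/-- Comparing integrals ball by ball with `||b x| - |b y|| ≤ |b x - b y|` shows that `|b x| 𝓜 f` and
`𝓜 (b f)` differ by at most the maximal commutator; the sign of `b x` produces the second term. -/
lemma abs_commutator_le {a β : ℝ} (hβ0 : 0 ≤ β) {b f : E n → ℝ} (hb : Integrable b (gauss n))
    (hf : MemLcInfty f) (x : E n) :
    (commutator a β b f x).abs ≤ maxCommutator a β b (fun y => ‖f y‖ₑ) x +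
      2 * ‖negPartFun b x‖ₑ * fracMaximal a β f x := by
  have hfm : AEMeasurable (fun y => ‖f y‖ₑ) (gauss n) := hf.1.1.enorm
  have hbm : AEMeasurable b (gauss n) := hb.aemeasurable
  have hdm : AEMeasurable (fun y => ‖b x - b y‖ₑ * ‖f y‖ₑ) (gauss n) :=
    (hbm.const_sub (b x)).enorm.mul hfm
  have hle : ∀ c r, Admissible a c r → x ∈ ball c r →
      (∫⁻ y in ball c r, ‖b x - b y‖ₑ * ‖f y‖ₑ ∂(gauss n)) / (gauss n (ball c r)) ^ (1 - β) ≤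
        maxCommutator a β b (fun y => ‖f y‖ₑ) x := fun c r hr hx =>
    le_iSup_of_le c <| le_iSup_of_le r <| le_iSup_of_le hr <| le_iSup_of_le hx le_rfl
  refine ereal_abs_mul_sub_le (hf.fracMaximal_ne_top hβ0 x) ?_ ?_
  · rw [fracMaximal_eq_gMax, fracMaximal_eq_gMax]
    simp only [gMax, ENNReal.mul_iSup]
    refine iSup_le fun c => iSup_le fun r => iSup_le fun hr => iSup_le fun hx => ?_
    refine le_trans ?_ (add_le_add (le_gMax _ hr hx) (hle c r hr hx))
    rw [← mul_div_assoc, ← ENNReal.add_div, ← lintegral_const_mul' _ _ enorm_ne_top,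
      ← lintegral_add_right' _ hdm.restrict]
    gcongr with y
    rw [enorm_mul, ← add_mul]
    gcongr
    simpa using enorm_add_le (b y) (b x - b y)
  · rw [fracMaximal_eq_gMax a β (fun y => b y * f y), gMax_le_iff]
    intro c r hr hx
    refine le_trans ?_ (add_le_add (mul_le_mul' le_rfl (le_gMax _ hr hx)) (hle c r hr hx))
    rw [← mul_div_assoc, ← ENNReal.add_div, ← lintegral_const_mul' _ _ enorm_ne_top,
      ← lintegral_add_right' _ hdm.restrict]
    gcongr with y
    rw [enorm_mul, ← add_mul]
    gcongr
    simpa using enorm_sub_le (a := b x) (b := b x - b y)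

lemma aemeasurable_commutator {a β : ℝ} {b f : E n → ℝ} (hb : AEMeasurable b (gauss n)) :
    AEMeasurable (commutator a β b f) (gauss n) := by
  have h1 : AEMeasurable (fun x => (b x : EReal) * (fracMaximal a β f x : EReal)) (gauss n) :=
    (measurable_coe_real_ereal.comp_aemeasurable hb).mul
      (measurable_coe_ennreal_ereal.comp (measurable_gMax a β _)).aemeasurable
  have h2 : Measurable (fun x => -(fracMaximal a β (fun y => b y * f y) x : EReal)) :=
    continuous_neg.measurable.comp (measurable_coe_ennreal_ereal.comp (measurable_gMax a β _))
  exact h1.add h2.aemeasurable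

lemma oscBound_of_bmoSeminorm_le {b : E n → ℝ} {t : ℝ≥0∞} (h : bmoSeminorm b ≤ t) :
    OscBound b 1 1 t := by
  intro c r hr
  simp only [ENNReal.rpow_one]
  refine (ENNReal.div_le_iff (gauss_ball_ne_zero c hr.1) (measure_ne_top _ _)).1 (le_trans ?_ h)
  exact le_iSup_of_le c <| le_iSup_of_le r <| le_iSup_of_le hr le_rfl

lemma bmoSeminorm_le_of_oscBound {b : E n → ℝ} {t : ℝ≥0∞} (h : OscBound b 1 1 t) :
    bmoSeminorm b ≤ t := by
  refine iSup_le fun c => iSup_le fun r => iSup_le fun hr => ENNReal.div_le_of_le_mul ?_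
  have := h c r hr
  simp only [ENNReal.rpow_one] at this
  exact this

/-- Boundedness of the commutator with a symbol in `BMO(γ)` whose negative part is bounded. -/
theorem exists_eLqNorm_commutator_le (n : ℕ) {a β p q : ℝ} (ha : 0 < a) (hβ0 : 0 < β)
    (hp : 1 < p) (hpq : p < q) (hβ : 1 / q = 1 / p - β) :
    ∃ C : ℝ≥0, 0 < C ∧ ∀ b f : E n → ℝ, MemBMO b → MemLcInfty f →
      eLqNorm q (commutator a β b f) ≤
        C * (bmoSeminorm b + eLpNorm (negPartFun b) ∞ (gauss n)) *
          eLpNorm f (ENNReal.ofReal p) (gauss n) := by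
  have hq1 : 1 < q := hp.trans hpq
  have hq0 : 0 < q := by linarith
  have hp0 : 0 < p := by linarith
  obtain ⟨C₁, hC₁0, hC₁⟩ := exists_lintegral_maxCommutator_rpow_le n ha hβ0 hp hpq hβ
  obtain ⟨C₂, hC₂0, hC₂⟩ := exists_lintegral_gMax_rpow_le n ha hβ0.le hp hq0 hβ
  set C₃ : ℝ≥0 := 2 ^ (q - 1) * (C₁ + 2 ^ q * C₂) with hC₃
  refine ⟨C₃ ^ (1 / q), by positivity, fun b f hb hf => ?_⟩
  have hbi : Integrable b (gauss n) := memLp_one_iff_integrable.1 hb.1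
  set L := eLpNorm (negPartFun b) ∞ (gauss n) with hL
  set I := ∫⁻ x, ‖f x‖ₑ ^ p ∂(gauss n) with hI
  have hfm : AEMeasurable (fun y => ‖f y‖ₑ) (gauss n) := hf.1.1.enorm
  have hfint : ∫⁻ y, ‖f y‖ₑ ∂(gauss n) ≠ ∞ := (hf.1.integrable le_top).2.ne
  have hnorm : eLpNorm f (ENNReal.ofReal p) (gauss n) = I ^ (1 / p) := by
    rw [eLpNorm_eq_lintegral_rpow_enorm_toReal (by simpa using hp0) (by simp),
      ENNReal.toReal_ofReal hp0.le]
  rw [hnorm]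
  have hLae : ∀ᵐ x ∂(gauss n), ‖negPartFun b x‖ₑ ≤ L := by
    rw [hL, eLpNorm_exponent_top]
    exact enorm_ae_le_eLpNormEssSup _ _
  -- The estimate of the maximal commutator needs `t ≠ 0`, while the seminorm may vanish; hence a
  -- strictly larger `t`, sent to the seminorm at the end.
  have key : ∀ t : ℝ≥0∞, bmoSeminorm b < t → t ≠ ∞ →
      eLqNorm q (commutator a β b f) ≤ ((C₃ ^ (1 / q) : ℝ≥0) : ℝ≥0∞) * (t + L) * I ^ (1 / p) := by
    intro t hbt ht
    have ht0 : t ≠ 0 := (bot_le.trans_lt hbt).ne'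
    have h1 := hC₁ b t _ hbi ht0 ht (oscBound_of_bmoSeminorm_le hbt.le) hfm hfint
    have h2 := hC₂ _ hfm
    have h3 : ∫⁻ x, (commutator a β b f x).abs ^ q ∂(gauss n) ≤
        C₃ * (t + L) ^ q * I ^ (q / p) := by
      calc ∫⁻ x, (commutator a β b f x).abs ^ q ∂(gauss n)
          ≤ ∫⁻ x, 2 ^ (q - 1) * (maxCommutator a β b (fun y => ‖f y‖ₑ) x ^ q +
              (2 * L) ^ q * fracMaximal a β f x ^ q) ∂(gauss n) := by
            refine lintegral_mono_ae ?_
            filter_upwards [hLae] with x hx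
            refine (ENNReal.rpow_le_rpow ((abs_commutator_le hβ0.le hbi hf x).trans
              (add_le_add le_rfl (mul_le_mul' (mul_le_mul' le_rfl hx) le_rfl))) hq0.le).trans ?_
            refine (ENNReal.rpow_add_le_mul_rpow_add_rpow _ _ hq1.le).trans (le_of_eq ?_)
            rw [ENNReal.mul_rpow_of_nonneg _ _ hq0.le]
        _ = 2 ^ (q - 1) * (∫⁻ x, maxCommutator a β b (fun y => ‖f y‖ₑ) x ^ q ∂(gauss n) +
              (2 * L) ^ q * ∫⁻ x, fracMaximal a β f x ^ q ∂(gauss n)) := by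
            have hm : Measurable (fun x => fracMaximal a β f x ^ q) :=
              (measurable_gMax a β _).pow_const q
            rw [lintegral_const_mul' _ _ (ENNReal.rpow_ne_top_of_nonneg (by linarith) (by simp)),
              lintegral_add_right _ (hm.const_mul _), lintegral_const_mul _ hm]
        _ ≤ 2 ^ (q - 1) * (C₁ * t ^ q * I ^ (q / p) + (2 * L) ^ q * (C₂ * I ^ (q / p))) := by
            gcongr
            exact h2
        _ ≤ 2 ^ (q - 1) * (C₁ * (t + L) ^ q * I ^ (q / p) +
              (2 * (t + L)) ^ q * (C₂ * I ^ (q / p))) := by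
            gcongr
            · exact le_self_add
            · exact le_add_self
        _ = _ := by
            rw [ENNReal.mul_rpow_of_nonneg _ _ hq0.le, hC₃]
            push_cast
            rw [ENNReal.coe_rpow_of_nonneg _ hq0.le, ENNReal.coe_rpow_of_nonneg _ (by linarith)]
            push_cast
            ring
    calc eLqNorm q (commutator a β b f) ≤ (C₃ * (t + L) ^ q * I ^ (q / p)) ^ (1 / q) := by
          unfold eLqNorm
          gcongr
      _ = _ := by
          rw [ENNReal.mul_rpow_of_nonneg _ _ (by positivity),
            ENNReal.mul_rpow_of_nonneg _ _ (by positivity), ← ENNReal.rpow_mul, ← ENNReal.rpow_mul,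
            mul_one_div_cancel hq0.ne', ENNReal.rpow_one,
            ENNReal.coe_rpow_of_nonneg _ (by positivity)]
          congr 2
          field_simp
  have hItop : I ^ (1 / p) ≠ ∞ := by
    rw [← hnorm]
    exact (hf.1.mono_exponent le_top).2.ne
  have hlim : Tendsto (fun k : ℕ => ((C₃ ^ (1 / q) : ℝ≥0) : ℝ≥0∞) *
      (bmoSeminorm b + ((k : ℝ≥0∞) + 1)⁻¹ + L) * I ^ (1 / p)) atTop
      (𝓝 (((C₃ ^ (1 / q) : ℝ≥0) : ℝ≥0∞) * (bmoSeminorm b + 0 + L) * I ^ (1 / p))) := by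
    refine ENNReal.Tendsto.mul_const (ENNReal.Tendsto.const_mul ?_ (Or.inr (by simp)))
      (Or.inr hItop)
    refine (tendsto_const_nhds.add ?_).add tendsto_const_nhds
    have := ENNReal.tendsto_inv_nat_nhds_zero.comp (tendsto_add_atTop_nat 1)
    simpa [Function.comp_def] using this
  rw [add_zero] at hlim
  refine ge_of_tendsto' hlim fun k => key _ ?_ ?_
  · exact ENNReal.lt_add_right hb.2.ne (by simp)
  · exact ENNReal.add_ne_top.2 ⟨hb.2.ne, by simp⟩

/-! ### Necessity: testing the commutator on balls -/

/-- A lower bound on `X` suffices, since enlarging `X` only pushes the difference further down; for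
`X = ∞` the difference is `⊥`, of infinite absolute value. -/
lemma ofReal_sub_mul_le_ereal_abs {u A : ℝ} {k : ℝ≥0} {X : ℝ≥0∞}
    (hX : ENNReal.ofReal A * k ≤ X) (hA : 0 ≤ A) :
    ENNReal.ofReal (A - u) * k ≤ ((u : EReal) * ((k : ℝ≥0∞) : EReal) - (X : EReal)).abs := by
  rcases eq_or_ne X ∞ with rfl | hXtop
  · have h : ((u : EReal) * ((k : ℝ≥0∞) : EReal) - ((∞ : ℝ≥0∞) : EReal)) = ⊥ := by
      rw [EReal.coe_ennreal_top, EReal.sub_top]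
    rw [h, EReal.abs_bot]
    exact le_top
  lift X to ℝ≥0 using hXtop
  have h3 : ((u : EReal) * ((k : ℝ≥0∞) : EReal) - ((X : ℝ≥0∞) : EReal)) =
      ((u * k - X : ℝ) : EReal) := by
    push_cast
    rfl
  rw [h3, EReal.abs_def, ← ENNReal.ofReal_coe_nnreal (p := k), ← ENNReal.ofReal_mul' k.coe_nonneg]
  rw [← ENNReal.ofReal_coe_nnreal (p := k), ← ENNReal.ofReal_mul hA,
    ← ENNReal.ofReal_coe_nnreal (p := X), ENNReal.ofReal_le_ofReal_iff X.coe_nonneg] at hX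
  refine ENNReal.ofReal_le_ofReal (le_trans ?_ (neg_le_abs _))
  linarith

lemma enorm_indicator_const {s : Set (E n)} {k : ℝ} (y : E n) :
    ‖s.indicator (fun _ => k) y‖ₑ = s.indicator (fun _ => ‖k‖ₑ) y := by
  by_cases hy : y ∈ s <;> simp [hy]

/-- The supremum is attained at the ball itself, because `γ(B ∩ B') ≤ γ(B) ^ β γ(B') ^ (1 - β)`. An
exact value is needed since it is multiplied by `b x`, whose sign is arbitrary. -/
lemma fracMaximal_indicator_const {a β : ℝ} (hβ0 : 0 ≤ β) (hβ1 : β ≤ 1) {c x : E n} {r : ℝ}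
    (hr : Admissible a c r) (hx : x ∈ ball c r) (k : ℝ) :
    fracMaximal a β ((ball c r).indicator fun _ => k) x = ‖k‖ₑ * gauss n (ball c r) ^ β := by
  have hint : ∀ c' r', ∫⁻ y in ball c' r', ‖(ball c r).indicator (fun _ => k) y‖ₑ ∂(gauss n) =
      ‖k‖ₑ * gauss n (ball c r ∩ ball c' r') := by
    intro c' r'
    simp only [enorm_indicator_const]
    rw [lintegral_indicator_const measurableSet_ball, Measure.restrict_apply measurableSet_ball]
  have hpow : ∀ w : ℝ≥0∞, w = w ^ β * w ^ (1 - β) := fun w => by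
    rw [← ENNReal.rpow_add_of_nonneg _ _ hβ0 (by linarith)]
    simp
  rw [fracMaximal_eq_gMax]
  apply le_antisymm
  · rw [gMax_le_iff]
    intro c' r' hr' hx'
    rw [hint]
    refine ENNReal.div_le_of_le_mul ?_
    calc ‖k‖ₑ * gauss n (ball c r ∩ ball c' r')
        = ‖k‖ₑ * (gauss n (ball c r ∩ ball c' r') ^ β *
          gauss n (ball c r ∩ ball c' r') ^ (1 - β)) := by rw [← hpow]
      _ ≤ ‖k‖ₑ * (gauss n (ball c r) ^ β * gauss n (ball c' r') ^ (1 - β)) := by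
          refine mul_le_mul' le_rfl (mul_le_mul' ?_ ?_)
          · exact ENNReal.rpow_le_rpow (measure_mono inter_subset_left) hβ0
          · exact ENNReal.rpow_le_rpow (measure_mono inter_subset_right) (by linarith)
      _ = _ := by ring
  · refine le_trans ?_ (le_gMax _ hr hx)
    rw [hint, inter_self]
    have hv0 : gauss n (ball c r) ≠ 0 := gauss_ball_ne_zero c hr.1
    have hvt : gauss n (ball c r) ≠ ∞ := measure_ne_top _ _
    rw [ENNReal.le_div_iff_mul_le, mul_assoc, ← hpow]
    · left; simp [ENNReal.rpow_eq_zero_iff, hv0, hvt]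
    · left; simp [ENNReal.rpow_eq_top_iff, hv0, hvt]

/-- Testing the commutator on a ball: the mean value over the ball of the positive part of
`|b|_B - b` is at most the norm of the commutator. -/
lemma lintegral_ofReal_average_abs_sub_le {a β p q : ℝ} (hβ0 : 0 ≤ β) (hβ1 : β ≤ 1)
    (hp : 1 < p) (hq : 1 < q) (hβ : 1 / q = 1 / p - β) {b : E n → ℝ} (hb : Integrable b (gauss n))
    {c : E n} {r : ℝ} (hr : Admissible a c r) :
    ∫⁻ x in ball c r, ENNReal.ofReal (ballAvg (fun y => |b y|) c r - b x) ∂(gauss n) ≤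
      commutatorNorm a β p q b * gauss n (ball c r) := by
  set v := gauss n (ball c r) with hv
  have hv0 : v ≠ 0 := gauss_ball_ne_zero c hr.1
  have hvt : v ≠ ∞ := measure_ne_top _ _
  have hp0 : 0 < p := by linarith
  have hq0 : 0 < q := by linarith
  set A := ballAvg (fun y => |b y|) c r with hA
  have hA0 : 0 ≤ A := by
    rw [hA, ballAvg, setAverage_eq]
    have : 0 ≤ ∫ y in ball c r, |b y| ∂(gauss n) := integral_nonneg fun _ => abs_nonneg _
    exact smul_nonneg (by positivity) this
  have hAv : ENNReal.ofReal A * v = ∫⁻ y in ball c r, ‖b y‖ₑ ∂(gauss n) := by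
    have h1 : ∫⁻ y in ball c r, ‖b y‖ₑ ∂(gauss n) =
        ENNReal.ofReal (∫ y in ball c r, |b y| ∂(gauss n)) :=
      (ofReal_integral_norm_eq_lintegral_enorm hb.integrableOn).symm
    rw [h1, hA, ballAvg, setAverage_eq, smul_eq_mul, ENNReal.ofReal_mul (by positivity), Measure.real,
      ← hv, ENNReal.ofReal_inv_of_pos (ENNReal.toReal_pos hv0 hvt),
      ENNReal.ofReal_toReal hvt, mul_comm, ← mul_assoc, ENNReal.mul_inv_cancel hv0 hvt, one_mul]
  -- This height gives `f` unit norm in `L^p`; its maximal function on the ball is then `v ^ (β - 1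
  -- / p) = v ^ (-(1 / q))`.
  set k : ℝ := (v ^ (-(1 / p))).toReal with hk
  have hkt : v ^ (-(1 / p)) ≠ ∞ := by simp [ENNReal.rpow_eq_top_iff, hv0, hvt]
  have hk' : ‖k‖ₑ = v ^ (-(1 / p)) := by
    rw [hk, Real.enorm_eq_ofReal ENNReal.toReal_nonneg, ENNReal.ofReal_toReal hkt]
  set f : E n → ℝ := (ball c r).indicator fun _ => k with hf
  have hfmem : MemLcInfty f := by
    constructor
    · exact memLp_indicator_const _ measurableSet_ball _ (Or.inr hvt)
    · refine HasCompactSupport.intro (isCompact_closedBall c r) fun x hx => ?_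
      exact indicator_of_notMem (fun h => hx (ball_subset_closedBall h)) _
  have hfnorm : eLpNorm f (ENNReal.ofReal p) (gauss n) = 1 := by
    rw [hf, eLpNorm_indicator_const measurableSet_ball (by simpa using hp0) (by simp), hk',
      ENNReal.toReal_ofReal hp0.le, ← hv, ← ENNReal.rpow_add _ _ hv0 hvt]
    simp
  have hcomm : eLqNorm q (commutator a β b f) ≤ commutatorNorm a β p q b :=
    le_iSup_of_le f <| le_iSup_of_le hfmem <| le_iSup_of_le hfnorm le_rfl
  have hkv : ‖k‖ₑ * v ^ β = v ^ (-(1 / q)) := by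
    rw [hk', ← ENNReal.rpow_add _ _ hv0 hvt]
    congr 1
    linarith
  set w : ℝ≥0 := (v ^ (-(1 / q))).toNNReal with hw
  have hw' : (w : ℝ≥0∞) = v ^ (-(1 / q)) := by
    rw [hw, ENNReal.coe_toNNReal]
    simp [ENNReal.rpow_eq_top_iff, hv0, hvt]
  have hpt : ∀ x ∈ ball c r, ENNReal.ofReal (A - b x) * w ≤ (commutator a β b f x).abs := by
    intro x hx
    have h1 : fracMaximal a β f x = w := by
      rw [hf, fracMaximal_indicator_const hβ0 hβ1 hr hx, hw', ← hkv]
    have h2 : ENNReal.ofReal A * w ≤ fracMaximal a β (fun y => b y * f y) x := by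
      rw [fracMaximal_eq_gMax]
      refine le_trans ?_ (le_gMax _ hr hx)
      have h3 : ∫⁻ y in ball c r, ‖b y * f y‖ₑ ∂(gauss n) = (ENNReal.ofReal A * v) * ‖k‖ₑ := by
        rw [hAv, ← lintegral_mul_const' _ _ enorm_ne_top]
        refine setLIntegral_congr_fun measurableSet_ball fun y hy => ?_
        simp only [hf, indicator_of_mem hy, enorm_mul]
      rw [h3, hw', ← hkv, ENNReal.le_div_iff_mul_le]
      · refine le_of_eq ?_
        have h4 : v ^ β * v ^ (1 - β) = v := by
          rw [← ENNReal.rpow_add _ _ hv0 hvt]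
          simp
        calc ENNReal.ofReal A * (‖k‖ₑ * v ^ β) * v ^ (1 - β)
            = ENNReal.ofReal A * ‖k‖ₑ * (v ^ β * v ^ (1 - β)) := by ring
          _ = _ := by
              rw [h4]
              ring
      · left; simp [ENNReal.rpow_eq_zero_iff, ← hv, hv0, hvt]
      · left; simp [ENNReal.rpow_eq_top_iff, ← hv, hv0, hvt]
    rw [commutator, h1]
    exact ofReal_sub_mul_le_ereal_abs h2 hA0
  have hpt' : ∀ x ∈ ball c r,
      ENNReal.ofReal (A - b x) ≤ v ^ (1 / q) * (commutator a β b f x).abs := by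
    intro x hx
    calc ENNReal.ofReal (A - b x) = v ^ (1 / q) * (ENNReal.ofReal (A - b x) * w) := by
          rw [mul_comm (ENNReal.ofReal _), ← mul_assoc, hw', ← ENNReal.rpow_add _ _ hv0 hvt]
          simp
      _ ≤ _ := by
          gcongr
          exact hpt x hx
  have hvq : v ^ (1 / q) ≠ ∞ := ENNReal.rpow_ne_top_of_nonneg (by positivity) hvt
  have hφ : AEMeasurable (fun x => ENNReal.ofReal (A - b x)) (gauss n) :=
    (hb.aemeasurable.const_sub A).ennreal_ofReal
  calc ∫⁻ x in ball c r, ENNReal.ofReal (A - b x) ∂(gauss n)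
      ≤ (∫⁻ x in ball c r, ENNReal.ofReal (A - b x) ^ q ∂(gauss n)) ^ (1 / q) *
        v ^ (1 - 1 / q) := by
        have := lintegral_le_rpow_mul_measure_rpow ((gauss n).restrict (ball c r)) hq hφ.restrict
        rwa [Measure.restrict_apply_univ] at this
    _ ≤ (∫⁻ x in ball c r, v * (commutator a β b f x).abs ^ q ∂(gauss n)) ^ (1 / q) *
        v ^ (1 - 1 / q) := by
        refine mul_le_mul' (ENNReal.rpow_le_rpow ?_ (by positivity)) le_rfl
        refine setLIntegral_mono' measurableSet_ball fun x hx => ?_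
        refine (ENNReal.rpow_le_rpow (hpt' x hx) hq0.le).trans (le_of_eq ?_)
        rw [ENNReal.mul_rpow_of_nonneg _ _ hq0.le, ← ENNReal.rpow_mul,
          one_div_mul_cancel hq0.ne', ENNReal.rpow_one]
    _ ≤ (v * ∫⁻ x, (commutator a β b f x).abs ^ q ∂(gauss n)) ^ (1 / q) * v ^ (1 - 1 / q) := by
        rw [lintegral_const_mul' _ _ hvt]
        gcongr
        exact Measure.restrict_le_self
    _ = eLqNorm q (commutator a β b f) * (v ^ (1 / q) * v ^ (1 - 1 / q)) := by
        rw [ENNReal.mul_rpow_of_nonneg _ _ (by positivity), eLqNorm]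
        ring
    _ = eLqNorm q (commutator a β b f) * v := by
        rw [← ENNReal.rpow_add _ _ hv0 hvt]
        simp
    _ ≤ _ := by gcongr

lemma ofReal_setIntegral_le_lintegral {h : E n → ℝ} {s : Set (E n)}
    (hh : IntegrableOn h s (gauss n)) :
    ENNReal.ofReal (∫ x in s, h x ∂(gauss n)) ≤ ∫⁻ x in s, ENNReal.ofReal (h x) ∂(gauss n) := by
  refine ENNReal.ofReal_le_of_le_toReal ?_
  rw [integral_eq_lintegral_pos_part_sub_lintegral_neg_part hh]
  exact sub_le_self _ ENNReal.toReal_nonneg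

lemma setIntegral_eq_ballAvg_mul (b : E n → ℝ) (c : E n) {r : ℝ} (hr : 0 < r) :
    ∫ y in ball c r, b y ∂(gauss n) = (gauss n).real (ball c r) * ballAvg b c r := by
  have hR : (gauss n).real (ball c r) ≠ 0 :=
    (ENNReal.toReal_pos (gauss_ball_ne_zero c hr) (measure_ne_top _ _)).ne'
  rw [ballAvg, setAverage_eq, smul_eq_mul, mul_inv_cancel_left₀ hR]

lemma ballAvg_le_ballAvg_abs {b : E n → ℝ} (hb : Integrable b (gauss n)) (c : E n) (r : ℝ) :
    ballAvg b c r ≤ ballAvg (fun y => |b y|) c r := by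
  rw [ballAvg, ballAvg, setAverage_eq, setAverage_eq]
  refine smul_le_smul_of_nonneg_left ?_ (by positivity)
  exact integral_mono hb.integrableOn hb.abs.integrableOn fun y => le_abs_self _

/-- `b - b_B` has integral zero, so its positive and negative parts have equal integrals. A
one-sided test thus controls the whole oscillation. -/
lemma lintegral_enorm_sub_ballAvg_eq {b : E n → ℝ} (hb : Integrable b (gauss n)) (c : E n) {r : ℝ}
    (hr : 0 < r) :
    ∫⁻ x in ball c r, ‖b x - ballAvg b c r‖ₑ ∂(gauss n) =
      2 * ∫⁻ x in ball c r, ENNReal.ofReal (ballAvg b c r - b x) ∂(gauss n) := by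
  set κ := ballAvg b c r with hκ
  have hi : IntegrableOn (fun x => b x - κ) (ball c r) (gauss n) :=
    (hb.sub (integrable_const κ)).integrableOn
  have h0 : ∫ x in ball c r, (b x - κ) ∂(gauss n) = 0 := by
    rw [integral_sub hb.integrableOn (integrable_const _), setIntegral_const,
      setIntegral_eq_ballAvg_mul b c hr, smul_eq_mul, sub_self]
  rw [integral_eq_lintegral_pos_part_sub_lintegral_neg_part hi] at h0
  have hfin1 : ∫⁻ x in ball c r, ENNReal.ofReal (b x - κ) ∂(gauss n) ≠ ∞ :=
    ne_top_of_le_ne_top hi.2.ne (lintegral_mono fun x => Real.ofReal_le_enorm _)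
  have hfin2 : ∫⁻ x in ball c r, ENNReal.ofReal (-(b x - κ)) ∂(gauss n) ≠ ∞ :=
    ne_top_of_le_ne_top hi.2.ne (lintegral_mono fun x => by
      rw [← enorm_neg]
      exact Real.ofReal_le_enorm _)
  have h1 := (ENNReal.toReal_eq_toReal_iff' hfin1 hfin2).1 (sub_eq_zero.1 h0)
  simp only [neg_sub] at h1
  have h2 : ∀ x, ‖b x - κ‖ₑ = ENNReal.ofReal (b x - κ) + ENNReal.ofReal (κ - b x) := by
    intro x
    rw [Real.enorm_eq_ofReal_abs]
    rcases le_total (b x) κ with h | h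
    · rw [abs_of_nonpos (by linarith), neg_sub, ENNReal.ofReal_of_nonpos (by linarith : b x - κ ≤ 0),
        zero_add]
    · rw [abs_of_nonneg (by linarith), ENNReal.ofReal_of_nonpos (by linarith : κ - b x ≤ 0),
        add_zero]
  simp only [h2]
  rw [lintegral_add_right' _ (hb.aemeasurable.const_sub κ).ennreal_ofReal.restrict, h1, two_mul]

/-- `b⁻ ≤ 2 b⁻ = |b| - b`, and over the ball `|b|` may be replaced by its mean without changing the
integral. -/
lemma lintegral_enorm_negPartFun_le {b : E n → ℝ} (hb : Integrable b (gauss n)) (c : E n) {r : ℝ}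
    (hr : 0 < r) :
    ∫⁻ x in ball c r, ‖negPartFun b x‖ₑ ∂(gauss n) ≤
      ∫⁻ x in ball c r, ENNReal.ofReal (ballAvg (fun y => |b y|) c r - b x) ∂(gauss n) := by
  set A := ballAvg (fun y => |b y|) c r with hA
  have hi : IntegrableOn (fun x => |b x| - b x) (ball c r) (gauss n) := (hb.abs.sub hb).integrableOn
  calc ∫⁻ x in ball c r, ‖negPartFun b x‖ₑ ∂(gauss n)
      ≤ ∫⁻ x in ball c r, ENNReal.ofReal (|b x| - b x) ∂(gauss n) := by
        refine lintegral_mono fun x => ?_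
        rw [negPartFun, Real.enorm_eq_ofReal_abs, abs_neg]
        refine ENNReal.ofReal_le_ofReal ?_
        rcases le_total 0 (b x) with h | h
        · rw [min_eq_left h, abs_zero]
          exact sub_nonneg.2 (le_abs_self _)
        · rw [min_eq_right h, abs_of_nonpos h]
          linarith
    _ = ENNReal.ofReal (∫ x in ball c r, (|b x| - b x) ∂(gauss n)) :=
        (ofReal_integral_eq_lintegral_ofReal hi
          (ae_of_all _ fun x => sub_nonneg.2 (le_abs_self _))).symm
    _ = ENNReal.ofReal (∫ x in ball c r, (A - b x) ∂(gauss n)) := by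
        rw [integral_sub hb.abs.integrableOn hb.integrableOn,
          integral_sub (integrable_const _) hb.integrableOn, setIntegral_const, smul_eq_mul,
          setIntegral_eq_ballAvg_mul _ c hr]
    _ ≤ _ := ofReal_setIntegral_le_lintegral (((integrable_const A).sub hb).integrableOn)

/-- All sufficiently small balls about a point are admissible, so Lebesgue differentiation applies.
-/
lemma eLpNorm_top_le_of_setLIntegral_ball_le {a : ℝ} (ha : 0 < a) {h : E n → ℝ}
    (hh : Integrable h (gauss n)) {N : ℝ≥0∞}
    (hN : ∀ c r, Admissible a c r →
      ∫⁻ x in ball c r, ‖h x‖ₑ ∂(gauss n) ≤ N * gauss n (ball c r)) :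
    eLpNorm h ∞ (gauss n) ≤ N := by
  rw [eLpNorm_exponent_top]
  refine eLpNormEssSup_le_of_ae_enorm_bound ?_
  filter_upwards [ae_tendsto_lintegral_ball_div hh.aemeasurable.enorm hh.2.ne] with x hx
  refine le_of_tendsto hx ?_
  filter_upwards [Ioo_mem_nhdsGT (mul_pos ha (m_pos x))] with r hr
  exact ENNReal.div_le_of_le_mul (hN x r ⟨hr.1, hr.2.le⟩)

lemma commutatorNorm_ne_top {a β p q : ℝ} {b : E n → ℝ} (h : CommutatorBounded a β p q b) :
    commutatorNorm a β p q b ≠ ∞ := by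
  obtain ⟨K, hK⟩ := h
  refine ne_top_of_le_ne_top (ENNReal.coe_ne_top (r := K)) ?_
  refine iSup_le fun f => iSup_le fun hf => iSup_le fun hf1 => ?_
  simpa [hf1] using hK f (hf.1.mono_exponent le_top) hf

/-- A symbol with bounded commutator belongs to `BMO(γ)` and has bounded negative part. -/
theorem exists_bmoSeminorm_le_commutatorNorm (n : ℕ) {a : ℝ} (ha : 0 < a) :
    ∃ C : ℝ≥0, 0 < C ∧ ∀ (β p q : ℝ) (b : E n → ℝ), 0 ≤ β → β ≤ 1 → 1 < p → 1 < q →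
      1 / q = 1 / p - β → Integrable b (gauss n) →
      bmoSeminorm b + eLpNorm (negPartFun b) ∞ (gauss n) ≤ C * commutatorNorm a β p q b := by
  -- Testing only reaches the balls of `𝓑_a`; enlargement with `s = 1` transfers the bound to `𝓑_1`
  -- even when `a < 1`.
  obtain ⟨C, hC⟩ := exists_oscBound_enlarge n ha one_pos le_rfl
  refine ⟨4 * C + 1, by positivity, fun β p q b hβ0 hβ1 hp hq hβ hb => ?_⟩
  set N := commutatorNorm a β p q b with hN
  have htest : ∀ c r, Admissible a c r →
      ∫⁻ x in ball c r, ENNReal.ofReal (ballAvg (fun y => |b y|) c r - b x) ∂(gauss n) ≤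
        N * gauss n (ball c r) := fun c r hr =>
    lintegral_ofReal_average_abs_sub_le hβ0 hβ1 hp hq hβ hb hr
  have hosc : OscBound b 1 a (2 * N) := by
    intro c r hr
    simp only [ENNReal.rpow_one]
    rw [lintegral_enorm_sub_ballAvg_eq hb c hr.1, mul_assoc]
    gcongr
    refine le_trans ?_ (htest c r hr)
    gcongr
    exact ballAvg_le_ballAvg_abs hb c r
  have hbmo : bmoSeminorm b ≤ C * (2 * N + (2 * N) ^ (1 : ℝ)) :=
    bmoSeminorm_le_of_oscBound (hC b _ _ hb hosc hosc)
  have hneg : eLpNorm (negPartFun b) ∞ (gauss n) ≤ N := by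
    refine eLpNorm_top_le_of_setLIntegral_ball_le ha ?_ fun c r hr =>
      (lintegral_enorm_negPartFun_le hb c hr.1).trans (htest c r hr)
    exact ((integrable_const 0).inf hb).neg
  refine (add_le_add hbmo hneg).trans (le_of_eq ?_)
  rw [ENNReal.rpow_one]
  push_cast
  ring

end GaussBMO

theorem theorem1p3 (n : ℕ) (hn : 1 ≤ n) (a β p q : ℝ) (ha : 0 < a) (hβ0 : 0 < β) (hβ1 : β < 1)
    (hp : 1 < p) (hpq : p < q) (hβ : 1 / q = 1 / p - β) :
    ∃ C : ℝ≥0, 0 < C ∧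
      (∀ b : GaussBMO.E n → ℝ, GaussBMO.MemBMO b →
        MemLp (GaussBMO.negPartFun b) ∞ (GaussBMO.gauss n) →
        ∀ f : GaussBMO.E n → ℝ, GaussBMO.MemLcInfty f →
          AEMeasurable (GaussBMO.commutator a β b f) (GaussBMO.gauss n) ∧
          GaussBMO.eLqNorm q (GaussBMO.commutator a β b f) ≤
            C * (GaussBMO.bmoSeminorm b +
                eLpNorm (GaussBMO.negPartFun b) ∞ (GaussBMO.gauss n)) *
              eLpNorm f (ENNReal.ofReal p) (GaussBMO.gauss n)) ∧
      (∀ b : GaussBMO.E n → ℝ, MemLp b 1 (GaussBMO.gauss n) →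
        GaussBMO.CommutatorBounded a β p q b →
        GaussBMO.MemBMO b ∧ MemLp (GaussBMO.negPartFun b) ∞ (GaussBMO.gauss n) ∧
          GaussBMO.bmoNorm b + eLpNorm (GaussBMO.negPartFun b) ∞ (GaussBMO.gauss n) ≤
            eLpNorm b 1 (GaussBMO.gauss n) + C * GaussBMO.commutatorNorm a β p q b) := by
  obtain ⟨C₁, hC₁0, hC₁⟩ := GaussBMO.exists_eLqNorm_commutator_le n ha hβ0 hp hpq hβ
  obtain ⟨C₂, hC₂0, hC₂⟩ := GaussBMO.exists_bmoSeminorm_le_commutatorNorm n ha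
  refine ⟨max C₁ C₂, lt_max_of_lt_left hC₁0, fun b hb hneg f hf => ⟨?_, ?_⟩, fun b hb hbd => ?_⟩
  · exact GaussBMO.aemeasurable_commutator hb.1.1.aemeasurable
  · refine (hC₁ b f hb hf).trans ?_
    gcongr
    exact le_max_left _ _
  · have hbi : Integrable b (GaussBMO.gauss n) := memLp_one_iff_integrable.1 hb
    have h := hC₂ β p q b hβ0.le hβ1.le hp (hp.trans hpq) hβ hbi
    have hfin : GaussBMO.bmoSeminorm b + eLpNorm (GaussBMO.negPartFun b) ∞ (GaussBMO.gauss n) < ∞ :=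
      h.trans_lt (ENNReal.mul_lt_top ENNReal.coe_lt_top
        (GaussBMO.commutatorNorm_ne_top hbd).lt_top)
    refine ⟨⟨hb, le_self_add.trans_lt hfin⟩, ⟨?_, le_add_self.trans_lt hfin⟩, ?_⟩
    · exact ((integrable_const (0 : ℝ)).inf hbi).neg.aestronglyMeasurable
    · rw [GaussBMO.bmoNorm, add_right_comm, add_comm]
      refine add_le_add le_rfl (h.trans ?_)
      gcongr
      exact le_max_right _ _
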